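/- **Setting.** A concurrent miner with $n$ threads executes a list of atomic-units (AUs), i.e. programs of reads and writes of shared objects and local steps. Each thread repeatedly takes the next AU from a shared counter and runs it as a transaction with a fresh unique timestamp $i\ge 1$ (the transaction is denoted $T_i$); whenever the transaction aborts, the AU is run again as a new transaction. Reads $r_i(x)$ and commit attempts $tryC_i$ are atomic operations of a software transactional memory that follows one of two protocols; writes are kept in a local log until the commit, and a read of an object that $T_i$ has itself already written is served from this log. * *BTO* (basic timestamp ordering, one version per object): $r_i(x)$ aborts iff a transaction with a larger timestamp has committed a write of $x$; $tryC_i$ aborts iff some object written by $T_i$ has been read, or overwritten by a commit, by a transaction with a larger timestamp. * *MVTO* (multi-version timestamp ordering): $r_i(x)$ returns the version of $x$ with the largest timestamp below $i$ (version $0$ is the initial value); $tryC_i$ aborts iff, for some object $x$ written by $T_i$, the version of $x$ with the largest timestamp below $i$ has been read by a transaction with a timestamp larger than $i$; otherwise a version with timestamp $i$ is added for each object that $T_i$ writes. At a successful $tryC_i$ the transactional memory records the conflict list of $T_i$: all transactions already committed then that wrote an object that $T_i$ reads or writes, or read an object that $T_i$ writes. The thread then, for each $j$ in this list, calls $addVert(j)$,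 $addVert(i)$, and $addEdge$ from the one of $i,j$ with the smaller timestamp to the other. The block graph (BG) is an adjacency list of sorted linked lists in shared memory; $addVert$ and $addEdge$ search for the position of a timestamp by following next pointers, return if it is present, and otherwise insert a new node by a compare-and-swap on the next pointer of the predecessor, searching on from the predecessor when this fails. Steps of different threads (single shared-memory accesses, operations of the transactional memory) interleave arbitrarily. In the history $H$ of operations executed so far, for distinct $k,m$, $T_k\prec T_m$ means: $tryC_k$ precedes $tryC_m$, both successful, and both transactions write a common object; or a successful $tryC_k$ precedes a successful read $r_m(x)$ of an object $x$ written by $T_k$; or a successful read $r_k(x)$ precedes a successful $tryC_m$ and $T_m$ writes $x$. Committed $T_i,T_j$ are *in conflict* if $T_i\prec T_j$ or $T_j\prec T_i$. For committed $T_k, T_m$ with $k\neq m$, there is a *dependency* $T_k\to T_m$ if: under BTO, $T_k\prec T_m$; under MVTO, $T_m$ reads a version written by $T_k$, or both write a common object and $k<m$, or $T_k$ reads a version $j$ of an object written by $T_m$ with $j<m$. **Theorem 3.** Under BTO and under MVTO, in every reachable state of the miner: 1. every vertex of the BG is the timestamp of a committed transaction and carries the identifier of the AU which that transaction executes; 2.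 every edge of the BG from $i$ to $j$ satisfies $i<j$, refers to a vertex of the BG with timestamp $j$, and joins two conflicting committed transactions; 3. if the committed transactions $T_i,T_j$ are in conflict, and no thread is still processing the conflict list of $T_i$ or $T_j$, then the BG contains the edge from $\min(i,j)$ to $\max(i,j)$; 4. if there is a dependency $T_k\to T_m$, and no thread is still processing the conflict list of $T_k$ or $T_m$, then $k<m$ and the BG contains the edge from $k$ to $m$. In particular, when all threads have finished, the BG has an edge from $i$ to $j$ if and only if $i<j$ and $T_i,T_j$ are committed and in conflict. -/

import Mathlib

universe u v

/-! ### Lock-free sorted linked lists -/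

/-- Keys of list nodes: a timestamp, or `-∞` / `+∞` for the two sentinels. -/
abbrev Key : Type := WithBot (WithTop ℕ)

/-- The key of a proper (non-sentinel) node. -/
def tsKey (i : ℕ) : Key := ((i : WithTop ℕ) : WithBot (WithTop ℕ))

/-- A node of a linked list in shared memory: its (immutable) key, the address of the next node,
and a payload. -/
structure ListNode (α : Type) where
  key : Key
  next : ℕ
  data : α

/-- The memory of a linked list.  The addresses below `size` are allocated; address `0` is the
head sentinel and address `1` is the tail sentinel. -/
structure LockFreeList (α : Type) where
  node : ℕ → ListNode α
  size : ℕ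

/-- The list that consists of the two sentinels (`d` is an irrelevant payload for them). -/
def LockFreeList.empty {α : Type} (d : α) : LockFreeList α where
  node a := if a = 0 then ⟨⊥, 1, d⟩ else ⟨⊤, 1, d⟩
  size := 2

/-- `l.Linked a`: the node at address `a` can be reached from the head sentinel by following
`next` pointers. -/
def LockFreeList.Linked {α : Type} (l : LockFreeList α) (a : ℕ) : Prop :=
  Relation.ReflTransGen (fun b c => (l.node b).next = c) 0 a

/-- The pair `⟨pred, curr⟩` that a thread keeps while it looks for the position of a key;
`curr = none` means that `pred.next` still has to be read. -/
structure Window where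
  pred : ℕ
  curr : Option ℕ

/-- The window with which a search starts: `pred` is the head sentinel. -/
def Window.start : Window := ⟨0, none⟩

/-- Result of one step of an insertion: it goes on with a new window, or returns
"already present" or "added", together with the address of the node. -/
inductive InsertResult where
  | again (w : Window)
  | present (a : ℕ)
  | added (a : ℕ)

/-- The compare-and-swap `pred.next.CAS(curr, new)`, where `new` is a newly allocated node with key
`k`, payload `d` and next pointer `curr`.  A new node is private to its thread until the swap
publishes it, so it is allocated in the step of a successful swap. -/
def LockFreeList.cas {α : Type} (l : LockFreeList α) (pred curr : ℕ) (k : Key) (d : α) :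
    LockFreeList α × InsertResult :=
  if (l.node pred).next = curr then
    ({ node := Function.update
        (Function.update l.node pred { l.node pred with next := l.size }) l.size ⟨k, curr, d⟩
       size := l.size + 1 }, .added l.size)
  else (l, .again ⟨pred, none⟩)

/-- One atomic step of the lock-free insertion of the key `k` with payload `d`: read `pred.next`;
or, once `curr` is known, move on if `curr.key < k`, return "already present" if `curr.key = k`,
and otherwise try the compare-and-swap, starting again from `pred` if it fails. -/
def LockFreeList.insertStep {α : Type} (l : LockFreeList α) (k : Key) (d : α) (w : Window) :
    LockFreeList α × InsertResult :=
  match w.curr with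
  | none => (l, .again ⟨w.pred, some (l.node w.pred).next⟩)
  | some c =>
    if (l.node c).key < k then (l, .again ⟨c, none⟩)
    else if (l.node c).key = k then (l, .present c)
    else l.cas w.pred c k d

/-- Overwrites the payload of the node at address `a`. -/
def LockFreeList.setData {α : Type} (l : LockFreeList α) (a : ℕ) (d : α) : LockFreeList α :=
  { l with node := Function.update l.node a { l.node a with data := d } }

/-! ### The block graph -/

/-- Payload of an edge node: the address of the vertex node of the target. -/
structure EdgeData where
  vref : ℕ

/-- Payload of a vertex node: identifier of the atomic-unit, in-degree counter, edge list. -/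
structure VertexData where
  auId : ℕ
  inCnt : ℕ
  edges : LockFreeList EdgeData

/-- The block graph is an adjacency list: the vertex list, each node of which holds its own
edge list. -/
abbrev BlockGraph : Type := LockFreeList VertexData

/-- Payload of a newly created vertex node. -/
def VertexData.new (au : ℕ) : VertexData := ⟨au, 0, LockFreeList.empty ⟨0⟩⟩

/-- The block graph without vertices. -/
def BlockGraph.initial : BlockGraph := LockFreeList.empty (VertexData.new 0)

/-- One atomic step of `addVert(i)` (`au` is the atomic-unit executed by `T_i`). -/
def BlockGraph.addVertStep (G : BlockGraph) (i au : ℕ) (w : Window) : BlockGraph × InsertResult :=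
  G.insertStep (tsKey i) (VertexData.new au) w

/-- One atomic step of `addEdge(fromNode, toNode)`, where the nodes are given by their addresses
`a` and `b` in the vertex list: insertion of `toNode.ts` into the edge list of `fromNode`. -/
def BlockGraph.addEdgeStep (G : BlockGraph) (a b : ℕ) (w : Window) : BlockGraph × InsertResult :=
  let r := (G.node a).data.edges.insertStep (G.node b).key ⟨b⟩ w
  (G.setData a { (G.node a).data with edges := r.1 }, r.2)

/-- The atomic increment of the in-degree counter of the vertex node at address `b`. -/
def BlockGraph.incInCnt (G : BlockGraph) (b : ℕ) : BlockGraph :=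
  G.setData b { (G.node b).data with inCnt := (G.node b).data.inCnt + 1 }

/-- The node at address `a` of the vertex list is a vertex of the graph, with timestamp `i`. -/
def BlockGraph.VertexAt (G : BlockGraph) (a i : ℕ) : Prop :=
  G.Linked a ∧ (G.node a).key = tsKey i

/-- The node at address `e` of the edge list of the vertex node `a` is an edge, to timestamp
`j`. -/
def BlockGraph.EdgeAt (G : BlockGraph) (a e j : ℕ) : Prop :=
  (G.node a).data.edges.Linked e ∧ ((G.node a).data.edges.node e).key = tsKey j

/-- The vertex node to which the edge node `e` in the edge list of the vertex node `a` refers. -/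
def BlockGraph.target (G : BlockGraph) (a e : ℕ) : ℕ :=
  ((G.node a).data.edges.node e).data.vref

/-- The block graph contains an edge from timestamp `i` to timestamp `j`: the edge list of a
vertex with timestamp `i` contains an edge node for `j` that refers to a vertex with
timestamp `j`. -/
def BlockGraph.HasEdge (G : BlockGraph) (i j : ℕ) : Prop :=
  ∃ a e, G.VertexAt a i ∧ G.EdgeAt a e j ∧ G.VertexAt (G.target a e) j

/-! ### Transactional memory: the two protocols

A transaction is identified with its timestamp.  Timestamp `0` belongs to the transaction that
initializes all objects.  Every operation of the transactional memory is one atomic event. -/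

/-- The shared part of a software transactional memory: its state, and the operations
`read_i(x)` (which returns `none` for an abort, and otherwise the timestamp of the transaction
that wrote the version that is read, and its value) and `tryC_i` for the write log of
`T_i` (which returns whether `T_i` commits). -/
structure STM (Obj : Type u) (Val : Type v) where
  State : Type (max u v)
  initial : State
  read : State → ℕ → Obj → State × Option (ℕ × Val)
  tryC : State → ℕ → List (Obj × Val) → State × Bool

/-- The set of objects in a write log. -/
def writeSet {Obj : Type u} {Val : Type v} [DecidableEq Obj] (wlog : List (Obj × Val)) :
    Finset Obj :=
  (wlog.map Prod.fst).toFinset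

/-- Basic timestamp ordering keeps, for each object, a single version, with the timestamp of its
writer, and the largest timestamp of a transaction that has read the object. -/
structure BTOCell (Val : Type v) where
  val : Val
  maxR : ℕ
  maxW : ℕ

/-- Basic timestamp ordering: an operation is rejected iff it comes too late, that is, iff a
conflicting operation of a younger transaction was executed before. Writes take effect
at the commit. -/
def bto {Obj : Type u} {Val : Type v} [DecidableEq Obj] (x₀ : Obj → Val) : STM Obj Val where
  State := ULift.{u} (Obj → BTOCell Val)
  initial := ⟨fun x => ⟨x₀ x, 0, 0⟩⟩
  read := fun σ i x =>
    if i < (σ.down x).maxW then (σ, none)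
    else (⟨Function.update σ.down x { σ.down x with maxR := max (σ.down x).maxR i }⟩,
      some ((σ.down x).maxW, (σ.down x).val))
  tryC := fun σ i wlog =>
    if ∃ x ∈ writeSet wlog, i < (σ.down x).maxR ∨ i < (σ.down x).maxW then (σ, false)
    else (⟨fun x => match wlog.lookup x with
      | some w => { σ.down x with val := w, maxW := i }
      | none => σ.down x⟩, true)

/-- Multi-version timestamp ordering keeps, for each object, the timestamps of its versions, and
for each version its value and the set of transactions that have read it. -/
structure MVTOCell (Val : Type v) where
  versions : Finset ℕ
  val : ℕ → Val
  readers : ℕ → Finset ℕ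

/-- The latest version that is older than `T_i`. -/
def MVTOCell.latest {Val : Type v} (c : MVTOCell Val) (i : ℕ) : ℕ :=
  (c.versions.filter (· < i)).sup id

/-- Multi-version timestamp ordering: `T_i` reads the latest version older than itself, and it is
aborted at its commit iff, for an object that it writes, the latest version older than `T_i` was
read by a transaction younger than `T_i`. -/
def mvto {Obj : Type u} {Val : Type v} [DecidableEq Obj] (x₀ : Obj → Val) : STM Obj Val where
  State := ULift.{u} (Obj → MVTOCell Val)
  initial := ⟨fun x => ⟨{0}, fun _ => x₀ x, fun _ => ∅⟩⟩
  read := fun σ i x =>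
    let c := σ.down x
    let j := c.latest i
    (⟨Function.update σ.down x
        { c with readers := Function.update c.readers j (insert i (c.readers j)) }⟩,
      some (j, c.val j))
  tryC := fun σ i wlog =>
    if ∃ x ∈ writeSet wlog, ∃ k ∈ (σ.down x).readers ((σ.down x).latest i), i < k then (σ, false)
    else (⟨fun x => match wlog.lookup x with
      | some w => { σ.down x with
          versions := insert i (σ.down x).versions
          val := Function.update (σ.down x).val i w }
      | none => σ.down x⟩, true)

/-- The two protocols. -/
inductive Protocol where
  | BTO
  | MVTO

/-- The transactional memory of a protocol; `x₀` are the initial values of the objects. -/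
def Protocol.stm {Obj : Type u} {Val : Type v} [DecidableEq Obj] (P : Protocol) (x₀ : Obj → Val) :
    STM Obj Val :=
  match P with
  | .BTO => bto x₀
  | .MVTO => mvto x₀

/-- The conflict lists that the transactional memory maintains: for each object the committed
transactions that have read it and that have written it, and for each committed transaction
its conflict list. -/
structure ConflictTable (Obj : Type u) where
  readersOf : Obj → Finset ℕ
  writersOf : Obj → Finset ℕ
  confList : ℕ → Finset ℕ

/-- No transaction has committed yet. -/
def ConflictTable.initial (Obj : Type u) : ConflictTable Obj := ⟨fun _ => ∅, fun _ => ∅, fun _ => ∅⟩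

/-- The update of the conflict lists by the successful `tryC_i` of a transaction with the given
read and write sets. -/
def ConflictTable.commit {Obj : Type u} [DecidableEq Obj] (c : ConflictTable Obj) (i : ℕ)
    (rset wset : Finset Obj) : ConflictTable Obj where
  readersOf x := if x ∈ rset then insert i (c.readersOf x) else c.readersOf x
  writersOf x := if x ∈ wset then insert i (c.writersOf x) else c.writersOf x
  confList := Function.update c.confList i
    (rset.biUnion c.writersOf ∪ wset.biUnion fun x => c.writersOf x ∪ c.readersOf x)

/-! ### Histories, conflicts and dependencies -/

/-- The events of a history.  In `read i x r`, `r = none` stands for an abort, and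
`r = some (j, v)` says that `T_i` reads from `T_j` the value `v`; in `tryC i b`, `b` says
whether `T_i` commits; `beginTx i au` starts `T_i`, which executes the atomic-unit number `au`. -/
inductive Event (Obj : Type u) (Val : Type v) where
  | beginTx (i au : ℕ)
  | read (i : ℕ) (x : Obj) (r : Option (ℕ × Val))
  | write (i : ℕ) (x : Obj) (w : Val)
  | tryC (i : ℕ) (b : Bool)

section History

variable {Obj : Type u} {Val : Type v}

/-- `T_i` is committed in the history `H`. -/
def Committed (H : List (Event Obj Val)) (i : ℕ) : Prop := Event.tryC i true ∈ H

/-- `T_i` writes the object `x` in `H`. -/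
def Writes (H : List (Event Obj Val)) (i : ℕ) (x : Obj) : Prop := ∃ w, Event.write i x w ∈ H

/-- `e` precedes `f` in `H`. -/
def Precedes (H : List (Event Obj Val)) (e f : Event Obj Val) : Prop := List.Sublist [e, f] H

/-- The conflict order `T_k ≺ T_m` of a history, on distinct transactions. -/
def ConflictOrder (H : List (Event Obj Val)) (k m : ℕ) : Prop :=
  k ≠ m ∧
    ((Precedes H (.tryC k true) (.tryC m true) ∧ ∃ x, Writes H k x ∧ Writes H m x) ∨
     (∃ x r, Precedes H (.tryC k true) (.read m x (some r)) ∧ Writes H k x) ∨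
     (∃ x r, Precedes H (.read k x (some r)) (.tryC m true) ∧ Writes H m x))

/-- Two committed transactions are in conflict. -/
def Conflicting (H : List (Event Obj Val)) (i j : ℕ) : Prop :=
  Committed H i ∧ Committed H j ∧ (ConflictOrder H i j ∨ ConflictOrder H j i)

/-- The multi-version dependencies `T_k → T_m` of a history, on distinct transactions, for the
version order given by the timestamps: `T_m` reads from `T_k`; or `T_k` writes an earlier
version of an object than `T_m`; or `T_k` reads a version of an object that is earlier than the
version that `T_m` writes. -/
def MVDependency (H : List (Event Obj Val)) (k m : ℕ) : Prop :=
  k ≠ m ∧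
    ((∃ x w, Event.read m x (some (k, w)) ∈ H) ∨
     (∃ x, Writes H k x ∧ Writes H m x ∧ k < m) ∨
     (∃ x j w, Event.read k x (some (j, w)) ∈ H ∧ Writes H m x ∧ j < m))

/-- In the serialization order of the protocol, the committed transaction `T_m` depends on the
committed transaction `T_k`. -/
def Dependency (P : Protocol) (H : List (Event Obj Val)) (k m : ℕ) : Prop :=
  Committed H k ∧ Committed H m ∧
    match P with
    | .BTO => ConflictOrder H k m
    | .MVTO => MVDependency H k m

end History

/-! ### The concurrent miner -/

/-- An atomic-unit: a program of reads, writes and local steps, in which each step may depend on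
the values read so far. -/
inductive AtomicUnit (Obj : Type u) (Val : Type v) where
  | ret
  | read (x : Obj) (next : Val → AtomicUnit Obj Val)
  | write (x : Obj) (w : Val) (next : AtomicUnit Obj Val)
  | skip (next : AtomicUnit Obj Val)

/-- The local state of a thread of the miner. -/
inductive ThreadState (Obj : Type u) (Val : Type v) where
  /-- about to take the next atomic-unit -/
  | fetch
  /-- about to begin a transaction for the atomic-unit number `au` with program `prog` -/
  | beginTx (au : ℕ) (prog : AtomicUnit Obj Val)
  /-- executing `T_i`; `cont` is the rest of the program -/
  | exec (au : ℕ) (prog : AtomicUnit Obj Val) (i : ℕ) (cont : AtomicUnit Obj Val)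
      (rset : Finset Obj) (wlog : List (Obj × Val))
  /-- `T_i` has committed; about to get its conflict list -/
  | committed (i : ℕ)
  /-- in the loop over the conflict list of `T_i` -/
  | loop (i : ℕ) (todo : List ℕ)
  /-- in `addVert(j)` -/
  | addVertJ (i j : ℕ) (todo : List ℕ) (w : Window)
  /-- in `addVert(i)`; `aj` is the address of the vertex node of `j` -/
  | addVertI (i j : ℕ) (todo : List ℕ) (aj : ℕ) (w : Window)
  /-- in `addEdge` from the vertex node `a` to the vertex node `b` -/
  | addEdge (i j : ℕ) (todo : List ℕ) (a b : ℕ) (w : Window)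
  /-- in `addEdge`, edge added; about to increment the in-degree counter of the vertex node `b` -/
  | incCnt (i j : ℕ) (todo : List ℕ) (b : ℕ)
  /-- no atomic-unit is left -/
  | finished

/-- The committed transaction whose conflicts the thread is adding to the block graph. -/
def ThreadState.building? {Obj : Type u} {Val : Type v} : ThreadState Obj Val → Option ℕ
  | .fetch => none
  | .beginTx _ _ => none
  | .exec _ _ _ _ _ _ => none
  | .committed i => some i
  | .loop i _ => some i
  | .addVertJ i _ _ _ => some i
  | .addVertI i _ _ _ _ => some i
  | .addEdge i _ _ _ _ _ => some i
  | .incCnt i _ _ _ => some i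
  | .finished => none

/-- The global state of a miner with `n` threads. -/
structure Miner {Obj : Type u} {Val : Type v} (M : STM Obj Val) (n : ℕ) where
  /-- state of the transactional memory -/
  tm : M.State
  /-- conflict lists in the transactional memory -/
  table : ConflictTable Obj
  /-- the next timestamp -/
  clock : ℕ
  /-- index of the next atomic-unit -/
  curInd : ℕ
  /-- the atomic-unit executed by a transaction -/
  auOf : ℕ → ℕ
  graph : BlockGraph
  thread : Fin n → ThreadState Obj Val
  /-- the history generated so far -/
  hist : List (Event Obj Val)

namespace Miner

variable {Obj : Type u} {Val : Type v} {M : STM Obj Val} {n : ℕ}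

/-- The initial state. -/
def initial (M : STM Obj Val) (n : ℕ) : Miner M n where
  tm := M.initial
  table := ConflictTable.initial Obj
  clock := 1
  curInd := 0
  auOf := fun _ => 0
  graph := BlockGraph.initial
  thread := fun _ => .fetch
  hist := []

/-- Sets the local state of the thread `t`. -/
def goto (s : Miner M n) (t : Fin n) (p : ThreadState Obj Val) : Miner M n :=
  { s with thread := Function.update s.thread t p }

/-- A step of the thread `t`, which executes `T_i`.  A read of an object that `T_i` has
itself written is served from its write log, without access to the shared object. -/
def execStep [DecidableEq Obj] (s : Miner M n) (t : Fin n) (au : ℕ) (prog : AtomicUnit Obj Val)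
    (i : ℕ) (cont : AtomicUnit Obj Val) (rset : Finset Obj) (wlog : List (Obj × Val)) :
    Miner M n :=
  match cont with
  | .skip next => s.goto t (.exec au prog i next rset wlog)
  | .write x w next =>
    { s with hist := s.hist ++ [Event.write i x w] }.goto t (.exec au prog i next rset ((x, w) :: wlog))
  | .read x next =>
    match wlog.lookup x with
    | some w => s.goto t (.exec au prog i (next w) rset wlog)
    | none =>
      let r := M.read s.tm i x
      { s with tm := r.1, hist := s.hist ++ [Event.read i x r.2] }.goto t
        (match r.2 with
          | none => .beginTx au prog
          | some (_, w) => .exec au prog i (next w) (insert x rset) wlog)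
  | .ret =>
    let r := M.tryC s.tm i wlog
    if r.2 then
      { s with
        tm := r.1
        table := s.table.commit i rset (writeSet wlog)
        hist := s.hist ++ [Event.tryC i true] }.goto t (.committed i)
    else
      { s with tm := r.1, hist := s.hist ++ [Event.tryC i false] }.goto t (.beginTx au prog)

/-- One atomic step of the thread `t`. -/
def step [DecidableEq Obj] (aus : List (AtomicUnit Obj Val)) (s : Miner M n) (t : Fin n) :
    Miner M n :=
  match s.thread t with
  | .fetch =>
    { s with curInd := s.curInd + 1 }.goto t
      (match aus[s.curInd]? with
        | some prog => .beginTx s.curInd prog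
        | none => .finished)
  | .beginTx au prog =>
    { s with
      clock := s.clock + 1
      auOf := Function.update s.auOf s.clock au
      hist := s.hist ++ [Event.beginTx s.clock au] }.goto t (.exec au prog s.clock prog ∅ [])
  | .exec au prog i cont rset wlog => s.execStep t au prog i cont rset wlog
  | .committed i =>
    s.goto t
      (if s.table.confList i = ∅ then .fetch
        else .loop i ((s.table.confList i).sort (· ≤ ·)))
  | .loop _ [] => s.goto t .fetch
  | .loop i (j :: todo) => s.goto t (.addVertJ i j todo Window.start)
  | .addVertJ i j todo w =>
    let r := s.graph.addVertStep j (s.auOf j) w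
    { s with graph := r.1 }.goto t
      (match r.2 with
        | .again w' => .addVertJ i j todo w'
        | .present a => .addVertI i j todo a Window.start
        | .added a => .addVertI i j todo a Window.start)
  | .addVertI i j todo aj w =>
    let r := s.graph.addVertStep i (s.auOf i) w
    let enter := fun a : ℕ =>
      if j < i then ThreadState.addEdge (Obj := Obj) (Val := Val) i j todo aj a Window.start
      else ThreadState.addEdge i j todo a aj Window.start
    { s with graph := r.1 }.goto t
      (match r.2 with
        | .again w' => .addVertI i j todo aj w'
        | .present a => enter a
        | .added a => enter a)
  | .addEdge i j todo a b w =>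
    let r := s.graph.addEdgeStep a b w
    { s with graph := r.1 }.goto t
      (match r.2 with
        | .again w' => .addEdge i j todo a b w'
        | .present _ => .loop i todo
        | .added _ => .incCnt i j todo b)
  | .incCnt i _ todo b => { s with graph := s.graph.incInCnt b }.goto t (.loop i todo)
  | .finished => s

/-- The states that the miner can reach on the list `aus` of atomic-units, under an arbitrary
interleaving of the steps of its threads. -/
inductive Reachable [DecidableEq Obj] (aus : List (AtomicUnit Obj Val)) : Miner M n → Prop where
  | initial : Reachable aus (Miner.initial M n)
  | step {s : Miner M n} (t : Fin n) : Reachable aus s → Reachable aus (s.step aus t)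

/-- Some thread is still adding the conflicts of the committed transaction `T_i` to the graph. -/
def Building (s : Miner M n) (i : ℕ) : Prop := ∃ t, (s.thread t).building? = some i

/-- All threads have finished. -/
def Finished (s : Miner M n) : Prop := ∀ t, s.thread t = .finished

end Miner

/-!
A conflict between committed transactions does not depend on the order of the events: it says that
both access a common object and that one of them writes it. Whichever of `T_i` and `T_j` commits
last therefore finds the other one in its conflict list, and the thread that executed it adds the
edge. Two facts make this survive all interleavings: the nodes of a list are never removed, so an
address that a thread remembers remains that of a node of the list, and a compare-and-swap on the
next pointer of such a node only adds a node.

A conflict edge is directed by the timestamps by construction. That a dependency has this direction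
too is a property of the protocol: under BTO the read and write timestamps of an object bound the
conflict order, and under MVTO a version that would come between a version and its reader is
rejected.
-/

/-! ### Histories -/

section PairSublist

variable {α : Type*} {a b c : α} {l : List α}

lemma pair_sublist_concat_iff :
    List.Sublist [a, b] (l ++ [c]) ↔ List.Sublist [a, b] l ∨ a ∈ l ∧ b = c := by
  rw [← List.reverse_sublist]
  simp [List.sublist_cons_iff, ← List.reverse_sublist (l₂ := l), and_comm, eq_comm]

lemma pair_sublist_or_pair_sublist (hab : a ≠ b) (ha : a ∈ l) (hb : b ∈ l) :
    List.Sublist [a, b] l ∨ List.Sublist [b, a] l := by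
  induction l with
  | nil => cases ha
  | cons c l ih =>
    rcases List.mem_cons.1 ha with rfl | ha'
    · exact .inl (.cons_cons a (by simpa [hab.symm] using hb))
    rcases List.mem_cons.1 hb with rfl | hb'
    · exact .inr (.cons_cons b (by simpa using ha'))
    exact (ih ha' hb').imp (·.cons c) (·.cons c)

end PairSublist

section History

variable {Obj : Type u} {Val : Type v} {H : List (Event Obj Val)} {e f g : Event Obj Val}
  {i j k m : ℕ} {x : Obj}

/-- The transaction that executes an event. -/
def Event.tx : Event Obj Val → ℕ
  | .beginTx i _ => i
  | .read i _ _ => i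
  | .write i _ _ => i
  | .tryC i _ => i

/-- `T_i` reads the object `x` in `H`, and the read is not aborted.  Reads that are served from the
write log of `T_i` are not events of a history. -/
def Reads (H : List (Event Obj Val)) (i : ℕ) (x : Obj) : Prop := ∃ r, Event.read i x (some r) ∈ H

/-- `T_i` and `T_j` access a common object, and at least one of them writes it. -/
def ConflictingAccess (H : List (Event Obj Val)) (i j : ℕ) : Prop :=
  ∃ x, Reads H i x ∧ Writes H j x ∨ Writes H i x ∧ (Writes H j x ∨ Reads H j x)

/-- The description of conflicts without the order of events, which is the one that the conflict
lists are computed from. -/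
def AccessConflict (H : List (Event Obj Val)) (i j : ℕ) : Prop :=
  i ≠ j ∧ Committed H i ∧ Committed H j ∧ ConflictingAccess H i j

lemma ConflictingAccess.symm (h : ConflictingAccess H i j) : ConflictingAccess H j i := by
  obtain ⟨x, ⟨hi, hj⟩ | ⟨hi, hj | hj⟩⟩ := h
  exacts [⟨x, .inr ⟨hj, .inr hi⟩⟩, ⟨x, .inr ⟨hj, .inl hi⟩⟩, ⟨x, .inl ⟨hj, hi⟩⟩]

lemma AccessConflict.symm (h : AccessConflict H i j) : AccessConflict H j i :=
  ⟨h.1.symm, h.2.2.1, h.2.1, h.2.2.2.symm⟩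

lemma accessConflict_comm : AccessConflict H i j ↔ AccessConflict H j i := ⟨.symm, .symm⟩

lemma Precedes.mem_left (h : Precedes H e f) : e ∈ H := List.Sublist.subset h (by simp)

lemma Precedes.mem_right (h : Precedes H e f) : f ∈ H := List.Sublist.subset h (by simp)

lemma ConflictOrder.conflictingAccess (h : ConflictOrder H i j) : ConflictingAccess H i j := by
  obtain ⟨-, ⟨-, x, hi, hj⟩ | ⟨x, r, hp, hi⟩ | ⟨x, r, hp, hj⟩⟩ := h
  exacts [⟨x, .inr ⟨hi, .inl hj⟩⟩, ⟨x, .inr ⟨hi, .inr ⟨r, hp.mem_right⟩⟩⟩,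
    ⟨x, .inl ⟨⟨r, hp.mem_left⟩, hj⟩⟩]

lemma conflictOrder_or_of_reads_of_writes (hij : i ≠ j) (hr : Reads H i x) (hj : Committed H j)
    (hw : Writes H j x) : ConflictOrder H i j ∨ ConflictOrder H j i := by
  obtain ⟨r, hr⟩ := hr
  exact (pair_sublist_or_pair_sublist (by simp) hr hj).imp
    (fun hp => ⟨hij, .inr (.inr ⟨x, r, hp, hw⟩)⟩)
    (fun hp => ⟨hij.symm, .inr (.inl ⟨x, r, hp, hw⟩)⟩)

lemma conflictOrder_or_of_writes_of_writes (hij : i ≠ j) (hi : Committed H i)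
    (hwi : Writes H i x) (hj : Committed H j) (hwj : Writes H j x) :
    ConflictOrder H i j ∨ ConflictOrder H j i :=
  (pair_sublist_or_pair_sublist (by simpa using hij) hi hj).imp
    (fun hp => ⟨hij, .inl ⟨hp, x, hwi, hwj⟩⟩)
    (fun hp => ⟨hij.symm, .inl ⟨hp, x, hwj, hwi⟩⟩)

lemma conflicting_iff_accessConflict : Conflicting H i j ↔ AccessConflict H i j := by
  constructor
  · rintro ⟨hi, hj, h | h⟩
    exacts [⟨h.1, hi, hj, h.conflictingAccess⟩, ⟨h.1.symm, hi, hj, h.conflictingAccess.symm⟩]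
  · rintro ⟨hij, hi, hj, x, ⟨hr, hw⟩ | ⟨hwi, hwj | hr⟩⟩
    exacts [⟨hi, hj, conflictOrder_or_of_reads_of_writes hij hr hj hw⟩,
      ⟨hi, hj, conflictOrder_or_of_writes_of_writes hij hi hwi hj hwj⟩,
      ⟨hi, hj, (conflictOrder_or_of_reads_of_writes hij.symm hr hi hwi).symm⟩]

@[simp]
lemma committed_concat_iff : Committed (H ++ [e]) i ↔ Committed H i ∨ e = .tryC i true := by
  simp [Committed, eq_comm]

@[simp]
lemma writes_concat_iff : Writes (H ++ [e]) i x ↔ Writes H i x ∨ ∃ w, e = .write i x w := by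
  simp [Writes, exists_or, eq_comm]

@[simp]
lemma reads_concat_iff : Reads (H ++ [e]) i x ↔ Reads H i x ∨ ∃ r, e = .read i x (some r) := by
  simp only [Reads, List.mem_append, List.mem_singleton, exists_or, eq_comm]

lemma precedes_concat_iff :
    Precedes (H ++ [e]) f g ↔ Precedes H f g ∨ f ∈ H ∧ g = e :=
  pair_sublist_concat_iff

lemma Committed.tx_ne (hi : Committed H i) (he : ¬ Committed H e.tx) : e.tx ≠ i :=
  fun h => he (h ▸ hi)

lemma committed_concat_iff_of_tx_ne (h : e.tx ≠ i) : Committed (H ++ [e]) i ↔ Committed H i := by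
  simp only [committed_concat_iff, or_iff_left_iff_imp]
  rintro rfl
  exact absurd rfl h

lemma writes_concat_iff_of_tx_ne (h : e.tx ≠ i) : Writes (H ++ [e]) i x ↔ Writes H i x := by
  simp only [writes_concat_iff, or_iff_left_iff_imp]
  rintro ⟨w, rfl⟩
  exact absurd rfl h

lemma reads_concat_iff_of_tx_ne (h : e.tx ≠ i) : Reads (H ++ [e]) i x ↔ Reads H i x := by
  simp only [reads_concat_iff, or_iff_left_iff_imp]
  rintro ⟨r, rfl⟩
  exact absurd rfl h

lemma AccessConflict.concat (h : AccessConflict H i j) : AccessConflict (H ++ [e]) i j := by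
  obtain ⟨hij, hi, hj, x, h⟩ := h
  refine ⟨hij, by simp [hi], by simp [hj], x, ?_⟩
  simp only [reads_concat_iff, writes_concat_iff]
  tauto

lemma accessConflict_concat_iff (he : ¬ Committed H e.tx) (hi : e ≠ .tryC i true)
    (hj : e ≠ .tryC j true) : AccessConflict (H ++ [e]) i j ↔ AccessConflict H i j := by
  refine ⟨fun ⟨hij, hci, hcj, hx⟩ => ?_, .concat⟩
  simp only [committed_concat_iff, hi, hj, or_false] at hci hcj
  simp only [ConflictingAccess, writes_concat_iff_of_tx_ne (hci.tx_ne he),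
    writes_concat_iff_of_tx_ne (hcj.tx_ne he), reads_concat_iff_of_tx_ne (hci.tx_ne he),
    reads_concat_iff_of_tx_ne (hcj.tx_ne he)] at hx
  exact ⟨hij, hci, hcj, hx⟩

lemma ConflictOrder.of_concat (he : ¬ Committed H e.tx) (h : ConflictOrder (H ++ [e]) k m) :
    ConflictOrder H k m ∨
      (e = .tryC m true ∧ ∃ x, Writes H m x ∧ (Committed H k ∧ Writes H k x ∨ Reads H k x)) ∨
      (∃ x r, e = .read m x (some r) ∧ Committed H k ∧ Writes H k x) := by
  have old_writes {i x} (hi : Committed H i) : Writes (H ++ [e]) i x → Writes H i x :=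
    (writes_concat_iff_of_tx_ne (hi.tx_ne he)).1
  obtain ⟨hkm, ⟨hp, x, hk, hm⟩ | ⟨x, r, hp, hk⟩ | ⟨x, r, hp, hm⟩⟩ := h <;>
    rcases precedes_concat_iff.1 hp with hp | ⟨hmem, rfl⟩
  · exact .inl ⟨hkm, .inl ⟨hp, x, old_writes hp.mem_left hk, old_writes hp.mem_right hm⟩⟩
  · exact .inr (.inl ⟨rfl, x, by simpa using hm, .inl ⟨hmem, old_writes hmem hk⟩⟩)
  · exact .inl ⟨hkm, .inr (.inl ⟨x, r, hp, old_writes hp.mem_left hk⟩)⟩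
  · exact .inr (.inr ⟨x, r, rfl, hmem, old_writes hmem hk⟩)
  · exact .inl ⟨hkm, .inr (.inr ⟨x, r, hp, old_writes hp.mem_right hm⟩)⟩
  · exact .inr (.inl ⟨rfl, x, by simpa using hm, .inr ⟨r, hmem⟩⟩)

end History

/-! ### Protocols -/

section Protocols

variable {Obj : Type u} {Val : Type v} {H : List (Event Obj Val)} {e : Event Obj Val}
  {i k m : ℕ} {x : Obj}

/-- `T_i` has added a version of the object `x` to the shared memory. -/
def Installed (H : List (Event Obj Val)) (i : ℕ) (x : Obj) : Prop := Committed H i ∧ Writes H i x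

lemma installed_concat_iff (he : ¬ Committed H e.tx) :
    Installed (H ++ [e]) i x ↔ Installed H i x ∨ e = .tryC i true ∧ Writes H i x := by
  by_cases hi : Committed H i
  · simp +contextual [Installed, hi, writes_concat_iff_of_tx_ne (hi.tx_ne he), -writes_concat_iff]
  · simp only [Installed, committed_concat_iff, writes_concat_iff]
    grind

/-- `M.Run σ H`: the operations in `H` lead from the initial state of `M` to `σ`.  No transaction
acts after its commit, and the write log that is passed to `tryC_i` covers exactly the writes of
`T_i`. -/
inductive STM.Run [DecidableEq Obj] (M : STM Obj Val) : M.State → List (Event Obj Val) → Prop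
  | nil : M.Run M.initial []
  | beginTx {σ H i} (au : ℕ) : M.Run σ H → ¬ Committed H i → M.Run σ (H ++ [.beginTx i au])
  | write {σ H i} (x : Obj) (w : Val) : M.Run σ H → ¬ Committed H i →
      M.Run σ (H ++ [.write i x w])
  | read {σ H i} (x : Obj) : M.Run σ H → ¬ Committed H i → 1 ≤ i →
      M.Run (M.read σ i x).1 (H ++ [.read i x (M.read σ i x).2])
  | tryC {σ H i wlog} : M.Run σ H → ¬ Committed H i → 1 ≤ i →
      (∀ x, x ∈ writeSet wlog ↔ Writes H i x) →
      M.Run (M.tryC σ i wlog).1 (H ++ [.tryC i (M.tryC σ i wlog).2])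

lemma STM.Run.one_le_of_committed [DecidableEq Obj] {M : STM Obj Val} {σ : M.State}
    (h : M.Run σ H) (hi : Committed H i) : 1 ≤ i := by
  induction h <;> grind [committed_concat_iff, Committed]

lemma mem_writeSet_iff_lookup_isSome [DecidableEq Obj] {wlog : List (Obj × Val)} :
    x ∈ writeSet wlog ↔ (wlog.lookup x).isSome := by
  simp [writeSet, List.lookup_isSome_iff]

/-- The invariant of basic timestamp ordering, which makes the conflict order agree with the order
of the timestamps. -/
structure BTOInvariant (c : Obj → BTOCell Val) (H : List (Event Obj Val)) : Prop where
  le_maxW : ∀ {k x}, Installed H k x → k ≤ (c x).maxW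
  le_maxR : ∀ {k x}, Reads H k x → k ≤ (c x).maxR
  lt_of_conflictOrder : ∀ {k m}, ConflictOrder H k m → k < m

lemma BTOInvariant.concat {c c' : Obj → BTOCell Val} (h : BTOInvariant c H)
    (he : ¬ Committed H e.tx) (hW : ∀ x, (c x).maxW ≤ (c' x).maxW)
    (hR : ∀ x, (c x).maxR ≤ (c' x).maxR)
    (hread : ∀ i x r, e = .read i x (some r) → (c x).maxW ≤ i ∧ i ≤ (c' x).maxR)
    (htryC : ∀ i x, e = .tryC i true → Writes H i x →
      (c x).maxR ≤ i ∧ (c x).maxW ≤ i ∧ i ≤ (c' x).maxW) :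
    BTOInvariant c' (H ++ [e]) where
  le_maxW {k x} hk := by
    rcases (installed_concat_iff he).1 hk with hk | ⟨he, hk⟩
    exacts [(h.le_maxW hk).trans (hW x), (htryC k x he hk).2.2]
  le_maxR {k x} hk := by
    rcases reads_concat_iff.1 hk with hk | ⟨r, he⟩
    exacts [(h.le_maxR hk).trans (hR x), (hread k x r he).2]
  lt_of_conflictOrder {k m} hkm := by
    refine lt_of_le_of_ne ?_ hkm.1
    rcases hkm.of_concat he with hkm | ⟨rfl, x, hm, hk⟩ | ⟨x, r, rfl, hk⟩
    · exact (h.lt_of_conflictOrder hkm).le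
    · obtain ⟨hmaxR, hmaxW, -⟩ := htryC m x rfl hm
      exact hk.elim (fun hk => (h.le_maxW hk).trans hmaxW) (fun hk => (h.le_maxR hk).trans hmaxR)
    · exact (h.le_maxW hk).trans (hread m x r rfl).1

lemma BTOInvariant.read [DecidableEq Obj] {x₀ : Obj → Val} {σ : (bto x₀).State}
    (h : BTOInvariant σ.down H) (hi : ¬ Committed H i) (x : Obj) :
    BTOInvariant ((bto x₀).read σ i x).1.down (H ++ [.read i x ((bto x₀).read σ i x).2]) := by
  by_cases hlate : i < (σ.down x).maxW
  · have hread : (bto x₀).read σ i x = (σ, none) := if_pos hlate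
    rw [hread]
    exact h.concat hi (by simp) (by simp) (by simp) (by simp)
  · have hread : (bto x₀).read σ i x =
        (⟨Function.update σ.down x { σ.down x with maxR := max (σ.down x).maxR i }⟩,
          some ((σ.down x).maxW, (σ.down x).val)) := if_neg hlate
    rw [hread]
    refine h.concat hi (fun y => ?_) (fun y => ?_) ?_ (by simp)
    · rcases eq_or_ne y x with rfl | hy <;> simp [*]
    · rcases eq_or_ne y x with rfl | hy <;> simp [*]
    · rintro _ _ _ ⟨⟩
      exact ⟨not_lt.1 hlate, by simp⟩

lemma BTOInvariant.tryC [DecidableEq Obj] {x₀ : Obj → Val} {σ : (bto x₀).State}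
    (h : BTOInvariant σ.down H) (hi : ¬ Committed H i) {wlog : List (Obj × Val)}
    (hwlog : ∀ x, x ∈ writeSet wlog ↔ Writes H i x) :
    BTOInvariant ((bto x₀).tryC σ i wlog).1.down
      (H ++ [.tryC i ((bto x₀).tryC σ i wlog).2]) := by
  by_cases habort : ∃ x ∈ writeSet wlog, i < (σ.down x).maxR ∨ i < (σ.down x).maxW
  · have htryC : (bto x₀).tryC σ i wlog = (σ, false) := if_pos habort
    rw [htryC]
    exact h.concat hi (by simp) (by simp) (by simp) (by simp)
  · have htryC : (bto x₀).tryC σ i wlog =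
        (⟨fun x => match wlog.lookup x with
          | some w => { σ.down x with val := w, maxW := i }
          | none => σ.down x⟩, true) := if_neg habort
    rw [htryC]
    push Not at habort
    refine h.concat hi (fun x => ?_) (fun x => ?_) (by simp) ?_
    · have hle := habort x
      rw [mem_writeSet_iff_lookup_isSome] at hle
      cases hx : wlog.lookup x with
      | none => simp [hx]
      | some w => simpa [hx] using (hle (by simp [hx])).2
    · cases hx : wlog.lookup x <;> simp [hx]
    · rintro _ x ⟨⟩ hx
      rw [← hwlog] at hx
      obtain ⟨w, hw⟩ := Option.isSome_iff_exists.1 (mem_writeSet_iff_lookup_isSome.1 hx)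
      exact ⟨(habort x hx).1, (habort x hx).2, by simp [hw]⟩

lemma STM.Run.btoInvariant [DecidableEq Obj] {x₀ : Obj → Val} {σ : (bto x₀).State}
    (h : (bto x₀).Run σ H) : BTOInvariant σ.down H := by
  induction h with
  | nil => exact ⟨by simp [Installed, Committed], by simp [Reads],
      by simp [ConflictOrder, Precedes, Writes]⟩
  | beginTx _ _ hi ih => exact ih.concat hi (by simp) (by simp) (by simp) (by simp)
  | write _ _ _ hi ih => exact ih.concat hi (by simp) (by simp) (by simp) (by simp)
  | read x _ hi _ ih => exact ih.read hi x
  | tryC _ hi _ hwlog ih => exact ih.tryC hi hwlog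

/-- The invariant of multi-version timestamp ordering, in particular that the version read by
a transaction remains the latest one older than it. -/
structure MVTOInvariant (c : Obj → MVTOCell Val) (H : List (Event Obj Val)) : Prop where
  mem_versions_iff : ∀ {k x}, k ∈ (c x).versions ↔ k = 0 ∨ Installed H k x
  mem_readers : ∀ {k x j v}, Event.read k x (some (j, v)) ∈ H → k ∈ (c x).readers j
  isGreatest : ∀ {k x j v}, Event.read k x (some (j, v)) ∈ H →
    IsGreatest {l | l ∈ (c x).versions ∧ l < k} j

lemma MVTOCell.isGreatest_latest {c : MVTOCell Val} (h0 : 0 ∈ c.versions) (hi : 1 ≤ i) :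
    IsGreatest {l | l ∈ c.versions ∧ l < i} (c.latest i) := by
  have hne : (c.versions.filter (· < i)).Nonempty := ⟨0, by simp [h0]; omega⟩
  have hmax := Finset.isGreatest_max' _ hne
  rw [latest, ← Finset.sup'_eq_sup hne]
  simpa [Finset.max'] using hmax

lemma MVTOInvariant.concat {c c' : Obj → MVTOCell Val} (h : MVTOInvariant c H)
    (he : ¬ Committed H e.tx)
    (hversions : ∀ k x, k ∈ (c' x).versions ↔
      k ∈ (c x).versions ∨ e = .tryC k true ∧ Writes H k x)
    (hreaders : ∀ x j, (c x).readers j ⊆ (c' x).readers j)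
    (hread : ∀ i x j v, e = .read i x (some (j, v)) →
      1 ≤ i ∧ j = (c x).latest i ∧ i ∈ (c' x).readers j)
    (htryC : ∀ i x, e = .tryC i true → Writes H i x →
      1 ≤ i ∧ ∀ k ∈ (c x).readers ((c x).latest i), k ≤ i) :
    MVTOInvariant c' (H ++ [e]) where
  mem_versions_iff {k x} := by
    rw [hversions, h.mem_versions_iff, installed_concat_iff he, or_assoc]
  mem_readers {k x j v} hk := by
    rcases List.mem_append.1 hk with hk | hk
    · exact hreaders x j (h.mem_readers hk)
    · exact (hread k x j v (List.mem_singleton.1 hk).symm).2.2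
  isGreatest {k x j v} hk := by
    rcases List.mem_append.1 hk with hk | hk
    · obtain ⟨⟨hj, hjk⟩, hmax⟩ := h.isGreatest hk
      refine ⟨⟨(hversions j x).2 (.inl hj), hjk⟩, fun i ⟨hi, hik⟩ => ?_⟩
      rcases (hversions i x).1 hi with hi | ⟨he, hi⟩
      · exact hmax ⟨hi, hik⟩
      by_contra! hji
      obtain ⟨hpos, hle⟩ := htryC i x he hi
      have hlatest := MVTOCell.isGreatest_latest (c := c x) (h.mem_versions_iff.2 (.inl rfl)) hpos
      have hj_eq : j = (c x).latest i := le_antisymm (hlatest.2 ⟨hj, hji⟩)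
        (hmax ⟨hlatest.1.1, hlatest.1.2.trans hik⟩)
      exact hik.not_ge (hle k (hj_eq ▸ h.mem_readers hk))
    · obtain rfl := List.mem_singleton.1 hk
      obtain ⟨hpos, rfl, -⟩ := hread k x j v rfl
      have hversions_eq : (c' x).versions = (c x).versions := by ext; simp [hversions]
      rw [hversions_eq]
      exact MVTOCell.isGreatest_latest (h.mem_versions_iff.2 (.inl rfl)) hpos

lemma MVTOInvariant.read [DecidableEq Obj] {x₀ : Obj → Val} {σ : (mvto x₀).State}
    (h : MVTOInvariant σ.down H) (hi : ¬ Committed H i) (hpos : 1 ≤ i) (x : Obj) :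
    MVTOInvariant ((mvto x₀).read σ i x).1.down (H ++ [.read i x ((mvto x₀).read σ i x).2]) := by
  refine h.concat hi (fun k y => ?_) (fun y j => ?_) ?_ (by simp [mvto])
  · rcases eq_or_ne y x with rfl | hy <;> simp [mvto, *]
  · rcases eq_or_ne y x with rfl | hy
    · rcases eq_or_ne j ((σ.down y).latest i) with rfl | hj <;> simp [mvto, *]
    · simp [mvto, *]
  · rintro _ _ _ _ ⟨⟩
    exact ⟨hpos, rfl, by simp [mvto]⟩

lemma MVTOInvariant.tryC [DecidableEq Obj] {x₀ : Obj → Val} {σ : (mvto x₀).State}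
    (h : MVTOInvariant σ.down H) (hi : ¬ Committed H i) (hpos : 1 ≤ i)
    {wlog : List (Obj × Val)} (hwlog : ∀ x, x ∈ writeSet wlog ↔ Writes H i x) :
    MVTOInvariant ((mvto x₀).tryC σ i wlog).1.down
      (H ++ [.tryC i ((mvto x₀).tryC σ i wlog).2]) := by
  by_cases habort : ∃ x ∈ writeSet wlog, ∃ k ∈ (σ.down x).readers ((σ.down x).latest i), i < k
  · have htryC : (mvto x₀).tryC σ i wlog = (σ, false) := if_pos habort
    rw [htryC]
    exact h.concat hi (by simp) (by simp) (by simp) (by simp)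
  · have htryC : (mvto x₀).tryC σ i wlog =
        (⟨fun x => match wlog.lookup x with
          | some w => { σ.down x with
              versions := insert i (σ.down x).versions
              val := Function.update (σ.down x).val i w }
          | none => σ.down x⟩, true) := if_neg habort
    rw [htryC]
    push Not at habort
    refine h.concat hi (fun k x => ?_) (fun x j => ?_) (by simp) ?_
    · have hx_written := hwlog x
      rw [mem_writeSet_iff_lookup_isSome] at hx_written
      cases hx : wlog.lookup x <;> grind
    · cases hx : wlog.lookup x <;> simp [hx]
    · rintro _ x ⟨⟩ hx
      exact ⟨hpos, habort x ((hwlog x).2 hx)⟩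

lemma STM.Run.mvtoInvariant [DecidableEq Obj] {x₀ : Obj → Val} {σ : (mvto x₀).State}
    (h : (mvto x₀).Run σ H) : MVTOInvariant σ.down H := by
  induction h with
  | nil => exact ⟨by simp [Installed, Committed, mvto], by simp, by simp⟩
  | beginTx _ _ hi ih => exact ih.concat hi (by simp) (by simp) (by simp) (by simp)
  | write _ _ _ hi ih => exact ih.concat hi (by simp) (by simp) (by simp) (by simp)
  | read x _ hi hpos ih => exact ih.read hi hpos x
  | tryC _ hi hpos hwlog ih => exact ih.tryC hi hpos hwlog

lemma MVTOInvariant.lt_and_accessConflict {c : Obj → MVTOCell Val} (h : MVTOInvariant c H)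
    (hk : Committed H k) (hm : Committed H m) (hk0 : 1 ≤ k) (hkm : MVDependency H k m) :
    k < m ∧ AccessConflict H k m := by
  obtain ⟨hne, ⟨x, w, hr⟩ | ⟨x, hwk, hwm, hlt⟩ | ⟨x, j, w, hr, hw, hjm⟩⟩ := hkm
  · obtain ⟨⟨hv, hlt⟩, -⟩ := h.isGreatest hr
    have hwk : Writes H k x := ((h.mem_versions_iff.1 hv).resolve_left (by omega)).2
    exact ⟨hlt, hne, hk, hm, x, .inr ⟨hwk, .inr ⟨_, hr⟩⟩⟩
  · exact ⟨hlt, hne, hk, hm, x, .inr ⟨hwk, .inl hwm⟩⟩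
  · refine ⟨?_, hne, hk, hm, x, .inl ⟨⟨_, hr⟩, hw⟩⟩
    by_contra! hmk
    have hm_version : m ∈ (c x).versions := h.mem_versions_iff.2 (.inr ⟨hm, hw⟩)
    exact hjm.not_ge ((h.isGreatest hr).2 ⟨hm_version, lt_of_le_of_ne hmk hne.symm⟩)

lemma Dependency.lt_and_conflicting [DecidableEq Obj] {P : Protocol} {x₀ : Obj → Val}
    {σ : (P.stm x₀).State} (h : (P.stm x₀).Run σ H) (hkm : Dependency P H k m) :
    k < m ∧ Conflicting H k m := by
  obtain ⟨hk, hm, hkm⟩ := hkm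
  cases P with
  | BTO => exact ⟨h.btoInvariant.lt_of_conflictOrder hkm, hk, hm, .inl hkm⟩
  | MVTO =>
    exact (h.mvtoInvariant.lt_and_accessConflict hk hm (h.one_le_of_committed hk) hkm).imp_right
      conflicting_iff_accessConflict.2

end Protocols

/-! ### Insertion into linked lists -/

namespace LockFreeList

variable {α : Type} {l l' : LockFreeList α} {a b c p i : ℕ} {k : Key} {d : α} {w : Window}
  {r : InsertResult}

/-- All nodes of the list are allocated, so that the address of a new node is not in use. -/
def Allocated (l : LockFreeList α) : Prop := ∀ a, l.Linked a → a < l.size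

/-- The window of a search consists of nodes of the list. -/
def LinkedWindow (l : LockFreeList α) (w : Window) : Prop :=
  l.Linked w.pred ∧ ∀ c, w.curr = some c → l.Linked c

/-- The list `l'` has all nodes of `l`, with the same keys and payloads. -/
structure Extends (l l' : LockFreeList α) : Prop where
  linked : ∀ {a}, l.Linked a → l'.Linked a
  key_eq : ∀ {a}, l.Linked a → (l'.node a).key = (l.node a).key
  data_eq : ∀ {a}, l.Linked a → (l'.node a).data = (l.node a).data

/-- The result of a step of the insertion of `k` is correct: a search that goes on is at nodes
of the list, and an address that is returned is that of a node with key `k`. -/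
def Locates (l : LockFreeList α) (k : Key) : InsertResult → Prop
  | .again w => l.LinkedWindow w
  | .present a => l.Linked a ∧ (l.node a).key = k
  | .added a => l.Linked a ∧ (l.node a).key = k

/-- The effect of a step of the insertion of the key `k` with payload `d` into the list `l`, where
`r` is the new list and the result of the step. -/
structure InsertSpec (l : LockFreeList α) (k : Key) (d : α) (r : LockFreeList α × InsertResult) :
    Prop where
  allocated : r.1.Allocated
  extends_fst : l.Extends r.1
  linked_or_eq : ∀ {a}, r.1.Linked a → l.Linked a ∨ (r.1.node a).key = k ∧ (r.1.node a).data = d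
  locates : r.1.Locates k r.2

/-- The list after a successful compare-and-swap on the next pointer of the node `p`. -/
def insertAfter (l : LockFreeList α) (p : ℕ) (k : Key) (d : α) : LockFreeList α where
  node := Function.update (Function.update l.node p { l.node p with next := l.size }) l.size
    ⟨k, (l.node p).next, d⟩
  size := l.size + 1

lemma linked_head (l : LockFreeList α) : l.Linked 0 := .refl

lemma Linked.next (h : l.Linked a) : l.Linked (l.node a).next := .tail h rfl

lemma linkedWindow_start (l : LockFreeList α) : l.LinkedWindow Window.start :=
  ⟨l.linked_head, by simp [Window.start]⟩

lemma LinkedWindow.mono (hl : ∀ {a}, l.Linked a → l'.Linked a) (hw : l.LinkedWindow w) :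
    l'.LinkedWindow w :=
  ⟨hl hw.1, fun c hc => hl (hw.2 c hc)⟩

lemma allocated_empty (d : α) : (empty d).Allocated := by
  have hlinked {a} (ha : (empty d).Linked a) : a = 0 ∨ a = 1 := by
    induction ha with
    | refl => exact .inl rfl
    | tail _ hnext ih => rcases ih with rfl | rfl <;> exact .inr hnext.symm
  intro a ha
  rcases hlinked ha with rfl | rfl <;> simp [empty]

lemma key_empty_ne_tsKey (d : α) (a i : ℕ) : ((empty d).node a).key ≠ tsKey i := by
  by_cases ha : a = 0
  · simp [empty, ha, tsKey]
  · simp only [empty, ha, if_false]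
    exact fun h => WithTop.top_ne_coe (WithBot.coe_injective h)

lemma Extends.refl (l : LockFreeList α) : l.Extends l := ⟨id, fun _ => rfl, fun _ => rfl⟩

lemma InsertSpec.of_unchanged (hl : l.Allocated) (hr : l.Locates k r) :
    l.InsertSpec k d (l, r) :=
  ⟨hl, .refl l, .inl, hr⟩

lemma node_insertAfter_size : (l.insertAfter p k d).node l.size = ⟨k, (l.node p).next, d⟩ := by
  simp [insertAfter]

lemma node_insertAfter_self (hp : p < l.size) :
    (l.insertAfter p k d).node p = { l.node p with next := l.size } := by
  simp [insertAfter, hp.ne]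

lemma node_insertAfter_of_ne (ha : a < l.size) (hap : a ≠ p) :
    (l.insertAfter p k d).node a = l.node a := by
  simp [insertAfter, ha.ne, hap]

lemma linked_insertAfter (hl : l.Allocated) (hp : l.Linked p) (ha : l.Linked a) :
    (l.insertAfter p k d).Linked a := by
  induction ha with
  | refl => exact linked_head _
  | @tail b c hb hbc ih =>
    rcases eq_or_ne b p with rfl | hbp
    · have hnew : (l.insertAfter b k d).Linked l.size :=
        ih.tail (by rw [node_insertAfter_self (hl _ hp)])
      exact hnew.tail (by rw [node_insertAfter_size, hbc])
    · exact ih.tail (by rw [node_insertAfter_of_ne (hl _ hb) hbp, hbc])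

lemma linked_insertAfter_iff (hl : l.Allocated) (hp : l.Linked p) :
    (l.insertAfter p k d).Linked a ↔ l.Linked a ∨ a = l.size := by
  refine ⟨fun ha => ?_, ?_⟩
  · induction ha with
    | refl => exact .inl l.linked_head
    | @tail b c _ hbc ih =>
      rcases ih with hb | rfl
      · rcases eq_or_ne b p with rfl | hbp
        · rw [node_insertAfter_self (hl _ hp)] at hbc
          exact .inr hbc.symm
        · rw [node_insertAfter_of_ne (hl _ hb) hbp] at hbc
          exact .inl (hb.tail hbc)
      · rw [node_insertAfter_size] at hbc
        exact .inl (hp.tail hbc)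
  · rintro (ha | rfl)
    · exact linked_insertAfter hl hp ha
    · exact (linked_insertAfter hl hp hp).tail (by rw [node_insertAfter_self (hl _ hp)])

lemma extends_insertAfter (hl : l.Allocated) (hp : l.Linked p) :
    l.Extends (l.insertAfter p k d) where
  linked := linked_insertAfter hl hp
  key_eq {a} ha := by
    rcases eq_or_ne a p with rfl | hap
    exacts [by rw [node_insertAfter_self (hl _ hp)], by rw [node_insertAfter_of_ne (hl _ ha) hap]]
  data_eq {a} ha := by
    rcases eq_or_ne a p with rfl | hap
    exacts [by rw [node_insertAfter_self (hl _ hp)], by rw [node_insertAfter_of_ne (hl _ ha) hap]]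

lemma insertSpec_insertAfter (hl : l.Allocated) (hp : l.Linked p) :
    l.InsertSpec k d (l.insertAfter p k d, .added l.size) where
  allocated a ha := by
    rcases (linked_insertAfter_iff hl hp).1 ha with ha | rfl
    exacts [(hl _ ha).trans l.size.lt_succ_self, l.size.lt_succ_self]
  extends_fst := extends_insertAfter hl hp
  linked_or_eq {a} ha := by
    refine ((linked_insertAfter_iff hl hp).1 ha).imp_right ?_
    rintro rfl
    simp [node_insertAfter_size]
  locates := ⟨(linked_insertAfter_iff hl hp).2 (.inr rfl), by rw [node_insertAfter_size]⟩

lemma insertSpec_cas (hl : l.Allocated) (hp : l.Linked p) : l.InsertSpec k d (l.cas p c k d) := by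
  by_cases hc : (l.node p).next = c
  · have hcas : l.cas p c k d = (l.insertAfter p k d, .added l.size) := by
      simp [cas, insertAfter, hc]
    exact hcas ▸ insertSpec_insertAfter hl hp
  · have hcas : l.cas p c k d = (l, .again ⟨p, none⟩) := if_neg hc
    exact hcas ▸ .of_unchanged hl ⟨hp, by simp⟩

lemma insertSpec_insertStep (hl : l.Allocated) (hw : l.LinkedWindow w) :
    l.InsertSpec k d (l.insertStep k d w) := by
  unfold insertStep
  rcases w with ⟨p, _ | c⟩
  · refine .of_unchanged hl ⟨hw.1, ?_⟩
    rintro _ ⟨⟩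
    exact hw.1.next
  · have hc : l.Linked c := hw.2 c rfl
    dsimp only
    split_ifs with hlt heq
    · exact .of_unchanged hl ⟨hc, by simp⟩
    · exact .of_unchanged hl ⟨hc, heq⟩
    · exact insertSpec_cas hl hw.1

@[simp]
lemma linked_setData_iff : (l.setData b d).Linked a ↔ l.Linked a := by
  have hnext (c) : ((l.setData b d).node c).next = (l.node c).next := by
    rcases eq_or_ne c b with rfl | hc <;> simp [setData, *]
  simp [Linked, hnext]

@[simp]
lemma key_setData : ((l.setData b d).node a).key = (l.node a).key := by
  rcases eq_or_ne a b with rfl | ha <;> simp [setData, *]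

@[simp]
lemma data_setData_self : ((l.setData a d).node a).data = d := by simp [setData]

lemma data_setData_of_ne (ha : a ≠ b) : ((l.setData b d).node a).data = (l.node a).data := by
  simp [setData, ha]

end LockFreeList

/-! ### Growth of the block graph -/

lemma tsKey_injective : Function.Injective tsKey :=
  WithBot.coe_injective.comp WithTop.coe_injective

namespace BlockGraph

variable {G G' : BlockGraph} {a b e i j au : ℕ} {w : Window} {d : VertexData}
  {V V' E E' : ℕ → ℕ → Prop}

/-- The graph `G'` arises from `G` by adding vertices and edges, and changing in-degree counters. -/
structure Extends (G G' : BlockGraph) : Prop where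
  linked : ∀ {a}, G.Linked a → G'.Linked a
  key_eq : ∀ {a}, G.Linked a → (G'.node a).key = (G.node a).key
  edges : ∀ {a}, G.Linked a → (G.node a).data.edges.Extends (G'.node a).data.edges

/-- The safety invariant of the block graph: its vertices, labelled with an atomic-unit, satisfy
`V`, and its edges satisfy `E` and refer to vertices. -/
structure Safe (G : BlockGraph) (V E : ℕ → ℕ → Prop) : Prop where
  allocated : LockFreeList.Allocated G
  edges_allocated : ∀ {a}, G.Linked a → (G.node a).data.edges.Allocated
  vertex : ∀ {a i}, G.VertexAt a i → V i (G.node a).data.auId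
  edge : ∀ {a e i j}, G.VertexAt a i → G.EdgeAt a e j → E i j ∧ G.VertexAt (G.target a e) j

lemma Extends.refl (G : BlockGraph) : G.Extends G := ⟨id, fun _ => rfl, fun _ => .refl _⟩

lemma Extends.of_list (h : LockFreeList.Extends G G') : G.Extends G' :=
  ⟨h.linked, h.key_eq, fun ha => h.data_eq ha ▸ .refl _⟩

lemma VertexAt.mono (ha : G.VertexAt a i) (h : G.Extends G') : G'.VertexAt a i :=
  ⟨h.linked ha.1, (h.key_eq ha.1).trans ha.2⟩

lemma EdgeAt.mono (he : G.EdgeAt a e j) (ha : G.Linked a) (h : G.Extends G') :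
    G'.EdgeAt a e j :=
  ⟨(h.edges ha).linked he.1, ((h.edges ha).key_eq he.1).trans he.2⟩

lemma EdgeAt.target_eq (he : G.EdgeAt a e j) (ha : G.Linked a) (h : G.Extends G') :
    G'.target a e = G.target a e :=
  congrArg EdgeData.vref ((h.edges ha).data_eq he.1)

lemma HasEdge.mono (hij : G.HasEdge i j) (h : G.Extends G') : G'.HasEdge i j := by
  obtain ⟨a, e, ha, he, ht⟩ := hij
  exact ⟨a, e, ha.mono h, he.mono ha.1 h, he.target_eq ha.1 h ▸ ht.mono h⟩

lemma Safe.hasEdge (hG : G.Safe V E) (ha : G.VertexAt a i) (he : G.EdgeAt a e j) :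
    G.HasEdge i j :=
  ⟨a, e, ha, he, (hG.edge ha he).2⟩

lemma Safe.imp (hG : G.Safe V E) (hV : ∀ i au, V i au → V' i au) (hE : ∀ i j, E i j → E' i j) :
    G.Safe V' E' :=
  ⟨hG.allocated, hG.edges_allocated, fun ha => hV _ _ (hG.vertex ha),
    fun ha he => (hG.edge ha he).imp_left (hE _ _)⟩

lemma safe_initial : initial.Safe V E where
  allocated := LockFreeList.allocated_empty _
  edges_allocated {a} _ := by
    have hdata : (initial.node a).data = VertexData.new 0 := by
      simp only [initial, LockFreeList.empty]
      split_ifs <;> rfl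
    exact hdata ▸ LockFreeList.allocated_empty _
  vertex ha := absurd ha.2 (LockFreeList.key_empty_ne_tsKey _ _ _)
  edge ha := absurd ha.2 (LockFreeList.key_empty_ne_tsKey _ _ _)

lemma Safe.of_insertSpec {r : BlockGraph × InsertResult} (hG : G.Safe V E) (hV : V i au)
    (h : LockFreeList.InsertSpec G (tsKey i) (VertexData.new au) r) : r.1.Safe V E where
  allocated := h.allocated
  edges_allocated {a} ha := by
    rcases h.linked_or_eq ha with ha | ⟨-, hdata⟩
    · exact h.extends_fst.data_eq ha ▸ hG.edges_allocated ha
    · exact hdata ▸ LockFreeList.allocated_empty _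
  vertex {a k} ha := by
    rcases h.linked_or_eq ha.1 with hold | ⟨hkey, hdata⟩
    · rw [h.extends_fst.data_eq hold]
      exact hG.vertex ⟨hold, h.extends_fst.key_eq hold ▸ ha.2⟩
    · obtain rfl : i = k := tsKey_injective (hkey.symm.trans ha.2)
      exact hdata ▸ hV
  edge {a e k j} ha he := by
    rcases h.linked_or_eq ha.1 with hold | ⟨-, hdata⟩
    · have he_old : G.EdgeAt a e j := by rwa [EdgeAt, h.extends_fst.data_eq hold] at he
      have hGext : G.Extends r.1 := .of_list h.extends_fst
      rw [he_old.target_eq hold hGext]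
      exact (hG.edge ⟨hold, h.extends_fst.key_eq hold ▸ ha.2⟩ he_old).imp_right (·.mono hGext)
    · rw [EdgeAt, hdata] at he
      exact absurd he.2 (LockFreeList.key_empty_ne_tsKey _ _ _)

lemma insertSpec_addVertStep (hG : G.Safe V E) (hw : LockFreeList.LinkedWindow G w) :
    LockFreeList.InsertSpec G (tsKey i) (VertexData.new au) (G.addVertStep i au w) :=
  LockFreeList.insertSpec_insertStep hG.allocated hw

@[simp]
lemma vertexAt_setData_iff : VertexAt (G.setData b d) a i ↔ G.VertexAt a i := by
  simp [VertexAt]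

lemma extends_setData (hd : (G.node a).data.edges.Extends d.edges) : G.Extends (G.setData a d) where
  linked := LockFreeList.linked_setData_iff.2
  key_eq _ := LockFreeList.key_setData
  edges {b} _ := by
    rcases eq_or_ne b a with rfl | hb
    · rwa [LockFreeList.data_setData_self]
    · exact LockFreeList.data_setData_of_ne hb ▸ .refl _

lemma Safe.setData (hG : G.Safe V E) (hau : d.auId = (G.node a).data.auId)
    (hal : d.edges.Allocated)
    (hedge : ∀ {i e j}, G.VertexAt a i → d.edges.Linked e → (d.edges.node e).key = tsKey j →
      E i j ∧ G.VertexAt (d.edges.node e).data.vref j) :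
    Safe (G.setData a d) V E where
  allocated _ hb := hG.allocated _ (LockFreeList.linked_setData_iff.1 hb)
  edges_allocated {b} hb := by
    rcases eq_or_ne b a with rfl | hba
    · rwa [LockFreeList.data_setData_self]
    · rw [LockFreeList.data_setData_of_ne hba]
      exact hG.edges_allocated (LockFreeList.linked_setData_iff.1 hb)
  vertex {b i} hb := by
    rw [vertexAt_setData_iff] at hb
    rcases eq_or_ne b a with rfl | hba
    · rw [LockFreeList.data_setData_self, hau]
      exact hG.vertex hb
    · rw [LockFreeList.data_setData_of_ne hba]
      exact hG.vertex hb
  edge {b e i j} hb he := by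
    rw [vertexAt_setData_iff] at hb ⊢
    rcases eq_or_ne b a with rfl | hba
    · rw [EdgeAt, LockFreeList.data_setData_self] at he
      rw [target, LockFreeList.data_setData_self]
      exact hedge hb he.1 he.2
    · rw [EdgeAt, LockFreeList.data_setData_of_ne hba] at he
      rw [target, LockFreeList.data_setData_of_ne hba]
      exact hG.edge hb he

lemma insertSpec_edges (hG : G.Safe V E) (ha : G.Linked a)
    (hw : (G.node a).data.edges.LinkedWindow w) :
    (G.node a).data.edges.InsertSpec (G.node b).key ⟨b⟩
      ((G.node a).data.edges.insertStep (G.node b).key ⟨b⟩ w) :=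
  LockFreeList.insertSpec_insertStep (hG.edges_allocated ha) hw

lemma extends_addEdgeStep (hG : G.Safe V E) (ha : G.Linked a)
    (hw : (G.node a).data.edges.LinkedWindow w) : G.Extends (G.addEdgeStep a b w).1 :=
  extends_setData (insertSpec_edges hG ha hw).extends_fst

lemma Safe.addEdgeStep (hG : G.Safe V E) (ha : G.VertexAt a i) (hb : G.VertexAt b j) (hE : E i j)
    (hw : (G.node a).data.edges.LinkedWindow w) : (G.addEdgeStep a b w).1.Safe V E := by
  have hspec := insertSpec_edges (b := b) hG ha.1 hw
  refine hG.setData rfl hspec.allocated fun {i' e j'} ha' he hkey => ?_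
  rcases hspec.linked_or_eq he with hold | ⟨hkey_new, hdata⟩
  · rw [hspec.extends_fst.key_eq hold] at hkey
    rw [hspec.extends_fst.data_eq hold]
    exact hG.edge ha' ⟨hold, hkey⟩
  · obtain rfl : i = i' := tsKey_injective (ha.2.symm.trans ha'.2)
    obtain rfl : j = j' := tsKey_injective (hb.2.symm.trans (hkey_new.symm.trans hkey))
    rw [hdata]
    exact ⟨hE, hb⟩

lemma locates_addEdgeStep (hG : G.Safe V E) (ha : G.Linked a) (hb : G.VertexAt b j)
    (hw : (G.node a).data.edges.LinkedWindow w) :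
    ((G.addEdgeStep a b w).1.node a).data.edges.Locates (tsKey j) (G.addEdgeStep a b w).2 := by
  rw [← hb.2, addEdgeStep, LockFreeList.data_setData_self]
  exact (insertSpec_edges hG ha hw).locates

lemma extends_incInCnt : G.Extends (G.incInCnt b) := extends_setData (.refl _)

lemma Safe.incInCnt (hG : G.Safe V E) (hb : G.Linked b) : (G.incInCnt b).Safe V E :=
  hG.setData rfl (hG.edges_allocated hb) fun hi he hkey => hG.edge hi ⟨he, hkey⟩

end BlockGraph

/-! ### Timestamps and conflict lists -/

section ConflictTable

variable {Obj : Type u} {Val : Type v} {H : List (Event Obj Val)} {e : Event Obj Val}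
  {i j k clock : ℕ} {x : Obj} {rset wset : Finset Obj} {auOf : ℕ → ℕ} {c : ConflictTable Obj}

/-- The timestamps that occur in `H` are those between `1` and `clock`, and `T_i` executes the
atomic-unit `auOf i`. -/
structure Timestamped (H : List (Event Obj Val)) (clock : ℕ) (auOf : ℕ → ℕ) : Prop where
  one_le_clock : 1 ≤ clock
  tx_mem_Ico : ∀ {e}, e ∈ H → e.tx ∈ Set.Ico 1 clock
  beginTx_mem : ∀ {i}, i ∈ Set.Ico 1 clock → Event.beginTx i (auOf i) ∈ H

lemma Timestamped.concat (h : Timestamped H clock auOf) (he : e.tx ∈ Set.Ico 1 clock) :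
    Timestamped (H ++ [e]) clock auOf where
  one_le_clock := h.one_le_clock
  tx_mem_Ico hf := by
    rcases List.mem_append.1 hf with hf | hf
    exacts [h.tx_mem_Ico hf, List.mem_singleton.1 hf ▸ he]
  beginTx_mem hi := List.mem_append_left _ (h.beginTx_mem hi)

lemma Timestamped.concat_beginTx (h : Timestamped H clock auOf) (au : ℕ) :
    Timestamped (H ++ [.beginTx clock au]) (clock + 1) (Function.update auOf clock au) where
  one_le_clock := Nat.le_add_left 1 clock
  tx_mem_Ico hf := by
    rcases List.mem_append.1 hf with hf | hf
    · exact Set.Ico_subset_Ico_right clock.le_succ (h.tx_mem_Ico hf)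
    · rw [List.mem_singleton.1 hf]
      exact ⟨h.one_le_clock, clock.lt_succ_self⟩
  beginTx_mem {i} hi := by
    rcases eq_or_ne i clock with rfl | hne
    · simp
    · have hmem := h.beginTx_mem ⟨hi.1, lt_of_le_of_ne (Nat.le_of_lt_succ hi.2) hne⟩
      simp [hne, hmem]

lemma Timestamped.beginTx_mem_of_committed (h : Timestamped H clock auOf) (hi : Committed H i) :
    Event.beginTx i (auOf i) ∈ H :=
  h.beginTx_mem (h.tx_mem_Ico hi)

/-- The conflict table is the one that belongs to the history `H`. -/
structure ConflictTable.Records (c : ConflictTable Obj) (H : List (Event Obj Val)) : Prop where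
  mem_readersOf_iff : ∀ {i x}, i ∈ c.readersOf x ↔ Committed H i ∧ Reads H i x
  mem_writersOf_iff : ∀ {i x}, i ∈ c.writersOf x ↔ Installed H i x
  accessConflict_iff : ∀ {i j}, AccessConflict H i j ↔ j ∈ c.confList i ∨ i ∈ c.confList j

namespace ConflictTable

lemma records_initial : (initial Obj).Records ([] : List (Event Obj Val)) := by
  constructor <;> simp [initial, Committed, Installed, AccessConflict]

lemma Records.concat (h : c.Records H) (he : ¬ Committed H e.tx)
    (hcommit : ∀ i, e ≠ .tryC i true) : c.Records (H ++ [e]) where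
  mem_readersOf_iff {i x} := by
    rw [h.mem_readersOf_iff, committed_concat_iff, or_iff_left (hcommit i)]
    exact and_congr_right fun hi => (reads_concat_iff_of_tx_ne (hi.tx_ne he)).symm
  mem_writersOf_iff {i x} := by
    simp [h.mem_writersOf_iff, installed_concat_iff he, hcommit]
  accessConflict_iff {i j} := by
    rw [accessConflict_concat_iff he (hcommit i) (hcommit j), h.accessConflict_iff]

lemma Records.mem_confList_commit_iff [DecidableEq Obj] (h : c.Records H)
    (hrset : ∀ x, x ∈ rset ↔ Reads H i x) (hwset : ∀ x, x ∈ wset ↔ Writes H i x) :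
    j ∈ (c.commit i rset wset).confList i ↔ Committed H j ∧ ConflictingAccess H i j := by
  simp only [commit, Function.update_self, Finset.mem_union, Finset.mem_biUnion, hrset, hwset,
    h.mem_writersOf_iff, h.mem_readersOf_iff, Installed, ConflictingAccess]
  grind

lemma confList_commit_of_ne [DecidableEq Obj] (hki : k ≠ i) :
    (c.commit i rset wset).confList k = c.confList k := by
  simp [commit, hki]

lemma accessConflict_concat_tryC_iff (hi : ¬ Committed H i) :
    AccessConflict (H ++ [.tryC i true]) i j ↔ Committed H j ∧ ConflictingAccess H i j := by
  simp only [AccessConflict, ConflictingAccess, committed_concat_iff, writes_concat_iff,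
    reads_concat_iff, Event.tryC.injEq, reduceCtorEq]
  grind

lemma Records.mem_confList_commit_or_iff [DecidableEq Obj] (h : c.Records H)
    (hi : ¬ Committed H i) (hrset : ∀ x, x ∈ rset ↔ Reads H i x)
    (hwset : ∀ x, x ∈ wset ↔ Writes H i x) :
    j ∈ (c.commit i rset wset).confList i ∨ i ∈ (c.commit i rset wset).confList j ↔
      Committed H j ∧ ConflictingAccess H i j := by
  rcases eq_or_ne j i with rfl | hji
  · rw [or_self, h.mem_confList_commit_iff hrset hwset]
  · have hold : i ∉ (c.commit i rset wset).confList j := by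
      rw [confList_commit_of_ne hji]
      exact fun hmem => hi (h.accessConflict_iff.2 (.inr hmem)).2.1
    rw [or_iff_left hold, h.mem_confList_commit_iff hrset hwset]

lemma Records.commit [DecidableEq Obj] (h : c.Records H) (hi : ¬ Committed H i)
    (hrset : ∀ x, x ∈ rset ↔ Reads H i x) (hwset : ∀ x, x ∈ wset ↔ Writes H i x) :
    (c.commit i rset wset).Records (H ++ [.tryC i true]) where
  mem_readersOf_iff {k x} := by
    have hmem := h.mem_readersOf_iff (i := k) (x := x)
    have hx := hrset x
    simp only [ConflictTable.commit, committed_concat_iff, reads_concat_iff]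
    grind
  mem_writersOf_iff {k x} := by
    have hmem := h.mem_writersOf_iff (i := k) (x := x)
    have hx := hwset x
    rw [installed_concat_iff hi]
    simp only [ConflictTable.commit]
    grind
  accessConflict_iff {k j} := by
    rcases eq_or_ne k i with rfl | hki
    · rw [accessConflict_concat_tryC_iff hi, h.mem_confList_commit_or_iff hi hrset hwset]
    rcases eq_or_ne j i with rfl | hji
    · rw [accessConflict_comm, or_comm, accessConflict_concat_tryC_iff hi,
        h.mem_confList_commit_or_iff hi hrset hwset]
    · rw [accessConflict_concat_iff hi (by simpa using hki.symm) (by simpa using hji.symm),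
        confList_commit_of_ne hki, confList_commit_of_ne hji, h.accessConflict_iff]

end ConflictTable

end ConflictTable

/-! ### States of a thread -/

section Threads

variable {Obj : Type u} {Val : Type v} {H : List (Event Obj Val)} {e : Event Obj Val}
  {i j k au : ℕ} {x : Obj} {w : Val} {rset : Finset Obj} {wlog : List (Obj × Val)}
  {G G' : BlockGraph} {p : ThreadState Obj Val}

/-- `T_i` executes the atomic-unit `au`, has not committed, and its local read set and write log
cover exactly its reads and writes in `H`. -/
structure Execution [DecidableEq Obj] (H : List (Event Obj Val)) (au i : ℕ) (rset : Finset Obj)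
    (wlog : List (Obj × Val)) : Prop where
  beginTx_mem : Event.beginTx i au ∈ H
  not_committed : ¬ Committed H i
  mem_rset_iff : ∀ x, x ∈ rset ↔ Reads H i x
  mem_writeSet_iff : ∀ x, x ∈ writeSet wlog ↔ Writes H i x

namespace Execution

variable [DecidableEq Obj]

lemma start (hi : ∀ e ∈ H, e.tx ≠ i) : Execution (H ++ [.beginTx i au]) au i ∅ [] where
  beginTx_mem := by simp
  not_committed := by simpa using fun hc : Committed H i => hi _ hc rfl
  mem_rset_iff x := by simpa using fun ⟨r, hr⟩ => hi _ hr rfl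
  mem_writeSet_iff x := by simpa [writeSet] using fun ⟨w, hw⟩ => hi _ hw rfl

lemma write (h : Execution H au i rset wlog) (x : Obj) (w : Val) :
    Execution (H ++ [.write i x w]) au i rset ((x, w) :: wlog) where
  beginTx_mem := by simp [h.beginTx_mem]
  not_committed := by simp [h.not_committed]
  mem_rset_iff y := by simp [h.mem_rset_iff]
  mem_writeSet_iff y := by
    have hy : y ∈ (wlog.map Prod.fst).toFinset ↔ Writes H i y := h.mem_writeSet_iff y
    simp [writeSet, ← hy, or_comm, eq_comm]

lemma read (h : Execution H au i rset wlog) (x : Obj) (r : ℕ × Val) :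
    Execution (H ++ [.read i x (some r)]) au i (insert x rset) wlog where
  beginTx_mem := by simp [h.beginTx_mem]
  not_committed := by simp [h.not_committed]
  mem_rset_iff y := by simp [h.mem_rset_iff, or_comm, eq_comm]
  mem_writeSet_iff y := by simp [h.mem_writeSet_iff]

lemma concat (h : Execution H au i rset wlog) (he : e.tx ≠ i) :
    Execution (H ++ [e]) au i rset wlog where
  beginTx_mem := List.mem_append_left _ h.beginTx_mem
  not_committed := by rw [committed_concat_iff_of_tx_ne he]; exact h.not_committed
  mem_rset_iff x := by rw [reads_concat_iff_of_tx_ne he, h.mem_rset_iff]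
  mem_writeSet_iff x := by rw [writes_concat_iff_of_tx_ne he, h.mem_writeSet_iff]

end Execution

/-- `T_i` may be the label of a vertex that carries the identifier `au`. -/
def JustifiedVertex (H : List (Event Obj Val)) (i au : ℕ) : Prop :=
  Committed H i ∧ Event.beginTx i au ∈ H

/-- The block graph may have an edge from `i` to `j`. -/
def JustifiedEdge (H : List (Event Obj Val)) (i j : ℕ) : Prop := i < j ∧ AccessConflict H i j

lemma AccessConflict.justifiedEdge (h : AccessConflict H i j) :
    JustifiedEdge H (min i j) (max i j) := by
  rcases lt_or_gt_of_ne h.1 with hij | hij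
  · simpa [JustifiedEdge, hij.le] using And.intro hij h
  · simpa [JustifiedEdge, hij.le] using And.intro hij h.symm

lemma JustifiedVertex.concat (h : JustifiedVertex H i au) : JustifiedVertex (H ++ [e]) i au :=
  h.imp (List.mem_append_left _) (List.mem_append_left _)

lemma JustifiedEdge.concat (h : JustifiedEdge H i j) : JustifiedEdge (H ++ [e]) i j :=
  h.imp_right .concat

namespace ThreadState

/-- The transaction that the thread executes. -/
def running? : ThreadState Obj Val → Option ℕ
  | .exec _ _ i _ _ _ => some i
  | _ => none

/-- The thread has not yet added the edge for the member `j` of the conflict list of `T_i`. -/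
def Pending (i j : ℕ) : ThreadState Obj Val → Prop
  | .committed i' => i' = i
  | .loop i' todo => i' = i ∧ j ∈ todo
  | .addVertJ i' j' todo _ => i' = i ∧ j ∈ j' :: todo
  | .addVertI i' j' todo _ _ => i' = i ∧ j ∈ j' :: todo
  | .addEdge i' j' todo _ _ _ => i' = i ∧ j ∈ j' :: todo
  | .incCnt i' _ todo _ => i' = i ∧ j ∈ todo
  | _ => False

/-- The local state of the thread agrees with the block graph `G` and the history `H`. -/
def Valid [DecidableEq Obj] (G : BlockGraph) (H : List (Event Obj Val)) :
    ThreadState Obj Val → Prop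
  | .exec au _ i _ rset wlog => Execution H au i rset wlog
  | .loop i todo => ∀ k ∈ todo, AccessConflict H i k
  | .addVertJ i j todo w =>
    (∀ k ∈ j :: todo, AccessConflict H i k) ∧ LockFreeList.LinkedWindow G w
  | .addVertI i j todo aj w =>
    (∀ k ∈ j :: todo, AccessConflict H i k) ∧ G.VertexAt aj j ∧ LockFreeList.LinkedWindow G w
  | .addEdge i j todo a b w =>
    (∀ k ∈ j :: todo, AccessConflict H i k) ∧ G.VertexAt a (min i j) ∧ G.VertexAt b (max i j) ∧
      (G.node a).data.edges.LinkedWindow w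
  | .incCnt i _ todo b => (∀ k ∈ todo, AccessConflict H i k) ∧ G.Linked b
  | _ => True

lemma Pending.building?_eq (h : p.Pending i j) : p.building? = some i := by
  cases p <;> simp_all [Pending, building?]

lemma Valid.mono [DecidableEq Obj] (h : p.Valid G H) (hG : G.Extends G') : p.Valid G' H := by
  cases p with
  | addVertJ => exact ⟨h.1, h.2.mono hG.linked⟩
  | addVertI => exact ⟨h.1, h.2.1.mono hG, h.2.2.mono hG.linked⟩
  | addEdge =>
    obtain ⟨hconf, ha, hb, hw⟩ := h
    exact ⟨hconf, ha.mono hG, hb.mono hG, hw.mono (hG.edges ha.1).linked⟩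
  | incCnt => exact ⟨h.1, hG.linked h.2⟩
  | _ => exact h

lemma Valid.concat [DecidableEq Obj] (h : p.Valid G H) (he : p.running? ≠ some e.tx) :
    p.Valid G (H ++ [e]) := by
  cases p with
  | exec => exact Execution.concat h fun hi => he (congrArg some hi.symm)
  | loop => exact fun k hk => (h k hk).concat
  | addVertJ | addVertI | addEdge | incCnt => exact h.imp_left fun hconf k hk => (hconf k hk).concat
  | _ => exact h

end ThreadState

end Threads

/-! ### The invariant of the miner -/

namespace Miner

variable {Obj : Type u} {Val : Type v} {M : STM Obj Val} {n : ℕ} {s : Miner M n} {t : Fin n}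
  {i j : ℕ} {p : ThreadState Obj Val} {e : Event Obj Val}

lemma Finished.not_building (hs : s.Finished) (i : ℕ) : ¬ s.Building i := by
  rintro ⟨t, ht⟩
  rw [hs t] at ht
  cases ht

variable [DecidableEq Obj]

/-- The invariant of the reachable states of the miner. -/
structure Invariant (s : Miner M n) : Prop where
  run : M.Run s.tm s.hist
  timestamped : Timestamped s.hist s.clock s.auOf
  records : s.table.Records s.hist
  safe : s.graph.Safe (JustifiedVertex s.hist) (JustifiedEdge s.hist)
  valid : ∀ t, (s.thread t).Valid s.graph s.hist
  running_unique : ∀ {t t' i}, (s.thread t).running? = some i →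
    (s.thread t').running? = some i → t = t'
  captured : ∀ {i j}, j ∈ s.table.confList i →
    s.graph.HasEdge (min i j) (max i j) ∨ ∃ t, (s.thread t).Pending i j

lemma invariant_initial : (initial M n).Invariant where
  run := .nil
  timestamped := ⟨le_rfl, by simp [initial], by simp [initial]⟩
  records := ConflictTable.records_initial
  safe := BlockGraph.safe_initial
  valid _ := trivial
  running_unique := by simp [initial, ThreadState.running?]
  captured := by simp [initial, ConflictTable.initial]

namespace Invariant

lemma valid_of_eq (h : s.Invariant) (ht : s.thread t = p) : p.Valid s.graph s.hist :=
  ht ▸ h.valid t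

lemma running_unique_update (h : s.Invariant)
    (hp : ∀ i, p.running? = some i → ∀ t', t' ≠ t → (s.thread t').running? ≠ some i) {t₁ t₂}
    (h₁ : (Function.update s.thread t p t₁).running? = some i)
    (h₂ : (Function.update s.thread t p t₂).running? = some i) : t₁ = t₂ := by
  rcases eq_or_ne t₁ t with ht₁ | ht₁ <;> rcases eq_or_ne t₂ t with ht₂ | ht₂
  · exact ht₁.trans ht₂.symm
  · rw [ht₁, Function.update_self] at h₁
    rw [Function.update_of_ne ht₂] at h₂
    exact absurd h₂ (hp i h₁ t₂ ht₂)
  · rw [Function.update_of_ne ht₁] at h₁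
    rw [ht₂, Function.update_self] at h₂
    exact absurd h₁ (hp i h₂ t₁ ht₁)
  · rw [Function.update_of_ne ht₁] at h₁
    rw [Function.update_of_ne ht₂] at h₂
    exact h.running_unique h₁ h₂

lemma goto {G : BlockGraph} {m : ℕ} (h : s.Invariant) (hG : s.graph.Extends G)
    (hsafe : G.Safe (JustifiedVertex s.hist) (JustifiedEdge s.hist)) (hp : p.Valid G s.hist)
    (hrunning : ∀ i, p.running? = some i → (s.thread t).running? = some i)
    (hpending : ∀ i j, j ∈ s.table.confList i → (s.thread t).Pending i j →
      p.Pending i j ∨ G.HasEdge (min i j) (max i j)) :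
    ({ s with graph := G, curInd := m }.goto t p).Invariant where
  run := h.run
  timestamped := h.timestamped
  records := h.records
  safe := hsafe
  valid := (Function.forall_update_iff _ fun _ q => ThreadState.Valid G s.hist q).2
    ⟨hp, fun t' _ => (h.valid t').mono hG⟩
  running_unique := h.running_unique_update fun i hi t' ht' hi' =>
    ht' (h.running_unique hi' (hrunning i hi))
  captured {i j} hj := by
    rcases h.captured hj with hedge | ⟨t', ht'⟩
    · exact .inl (hedge.mono hG)
    rcases eq_or_ne t' t with rfl | hne
    · exact (hpending i j hj ht').symm.imp_right fun hp => ⟨t', by simpa [Miner.goto] using hp⟩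
    · exact .inr ⟨t', by simpa [Miner.goto, hne] using ht'⟩

lemma concat {σ : M.State} {c : ConflictTable Obj} {clock : ℕ} {auOf : ℕ → ℕ} (h : s.Invariant)
    (hrun : M.Run σ (s.hist ++ [e])) (htime : Timestamped (s.hist ++ [e]) clock auOf)
    (hrec : c.Records (s.hist ++ [e])) (hp : p.Valid s.graph (s.hist ++ [e]))
    (hfresh : ∀ t', t' ≠ t → (s.thread t').running? ≠ some e.tx)
    (hrunning : ∀ i, p.running? = some i → i = e.tx)
    (hpending : ∀ i j, ¬ (s.thread t).Pending i j)
    (hconf : ∀ i j, j ∈ c.confList i → j ∈ s.table.confList i ∨ p.Pending i j) :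
    ({ s with tm := σ, table := c, clock := clock, auOf := auOf, hist := s.hist ++ [e] }.goto t
      p).Invariant where
  run := hrun
  timestamped := htime
  records := hrec
  safe := h.safe.imp (fun _ _ => .concat) (fun _ _ => .concat)
  valid := (Function.forall_update_iff _ fun _ q =>
    ThreadState.Valid s.graph (s.hist ++ [e]) q).2
      ⟨hp, fun t' ht' => (h.valid t').concat (hfresh t' ht')⟩
  running_unique := h.running_unique_update fun i hi t' ht' => hrunning i hi ▸ hfresh t' ht'
  captured {i j} hj := by
    rcases hconf i j hj with hj | hp
    · refine (h.captured hj).imp_right fun ⟨t', ht'⟩ => ⟨t', ?_⟩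
      have hne : t' ≠ t := fun heq => hpending i j (heq ▸ ht')
      simpa [Miner.goto, hne] using ht'
    · exact .inr ⟨t, by simpa [Miner.goto] using hp⟩

/-! ### The steps of a thread -/

section Exec

variable {au : ℕ} {prog cont next : AtomicUnit Obj Val} {rset : Finset Obj}
  {wlog : List (Obj × Val)} {x : Obj}

lemma concat_exec {σ : M.State} (h : s.Invariant)
    (hthread : s.thread t = .exec au prog i cont rset wlog) (htx : e.tx = i)
    (hcommit : ∀ j, e ≠ .tryC j true) (hrun : M.Run σ (s.hist ++ [e]))
    (hp : p.Valid s.graph (s.hist ++ [e])) (hrunning : ∀ j, p.running? = some j → j = i) :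
    ({ s with tm := σ, hist := s.hist ++ [e] }.goto t p).Invariant := by
  have hexec : Execution s.hist au i rset wlog := h.valid_of_eq hthread
  have hrunning_t : (s.thread t).running? = some i := by rw [hthread]; rfl
  have hmem : i ∈ Set.Ico 1 s.clock := h.timestamped.tx_mem_Ico hexec.beginTx_mem
  subst htx
  exact h.concat hrun (h.timestamped.concat hmem)
    (h.records.concat hexec.not_committed hcommit) hp
    (fun t' ht' hi => ht' (h.running_unique hi hrunning_t)) hrunning
    (by simp [hthread, ThreadState.Pending]) (fun _ _ => .inl)

lemma execStep_skip (h : s.Invariant)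
    (hthread : s.thread t = .exec au prog i (.skip next) rset wlog) :
    (s.execStep t au prog i (.skip next) rset wlog).Invariant := by
  have hexec : Execution s.hist au i rset wlog := h.valid_of_eq hthread
  exact h.goto (.refl _) h.safe hexec (by simp [hthread, ThreadState.running?])
    (by simp [hthread, ThreadState.Pending])

lemma execStep_write {w : Val} (h : s.Invariant)
    (hthread : s.thread t = .exec au prog i (.write x w next) rset wlog) :
    (s.execStep t au prog i (.write x w next) rset wlog).Invariant := by
  have hexec : Execution s.hist au i rset wlog := h.valid_of_eq hthread
  exact h.concat_exec hthread rfl (by simp) (h.run.write x w hexec.not_committed)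
    (hexec.write x w) (by simp [ThreadState.running?, eq_comm])

lemma execStep_read {next : Val → AtomicUnit Obj Val} (h : s.Invariant)
    (hthread : s.thread t = .exec au prog i (.read x next) rset wlog) :
    (s.execStep t au prog i (.read x next) rset wlog).Invariant := by
  have hexec : Execution s.hist au i rset wlog := h.valid_of_eq hthread
  simp only [execStep]
  split
  · exact h.goto (.refl _) h.safe hexec (by simp [hthread, ThreadState.running?])
      (by simp [hthread, ThreadState.Pending])
  · have hpos : 1 ≤ i := (h.timestamped.tx_mem_Ico hexec.beginTx_mem).1
    have hrun := h.run.read x hexec.not_committed hpos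
    refine h.concat_exec hthread rfl (by simp) hrun ?_ ?_
    · rcases (M.read s.tm i x).2 with _ | r
      exacts [trivial, hexec.read x r]
    · cases (M.read s.tm i x).2 <;> simp [ThreadState.running?, eq_comm]

lemma execStep_ret (h : s.Invariant) (hthread : s.thread t = .exec au prog i .ret rset wlog) :
    (s.execStep t au prog i .ret rset wlog).Invariant := by
  have hexec : Execution s.hist au i rset wlog := h.valid_of_eq hthread
  have hmem : i ∈ Set.Ico 1 s.clock := h.timestamped.tx_mem_Ico hexec.beginTx_mem
  have hrun := h.run.tryC hexec.not_committed hmem.1 hexec.mem_writeSet_iff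
  simp only [execStep]
  split_ifs with hcommit
  · rw [hcommit] at hrun
    have hrunning : (s.thread t).running? = some i := by rw [hthread]; rfl
    refine h.concat hrun (h.timestamped.concat hmem)
      (h.records.commit hexec.not_committed hexec.mem_rset_iff hexec.mem_writeSet_iff) trivial
      (fun t' ht' hi => ht' (h.running_unique hi hrunning)) (by simp [ThreadState.running?])
      (by simp [hthread, ThreadState.Pending]) fun k j hj => ?_
    rcases eq_or_ne k i with rfl | hki
    · exact .inr rfl
    · exact .inl (by rwa [ConflictTable.confList_commit_of_ne hki] at hj)
  · rw [Bool.not_eq_true] at hcommit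
    rw [hcommit] at hrun
    exact h.concat_exec hthread rfl (by simp) hrun trivial (by simp [ThreadState.running?])

end Exec

variable {aus : List (AtomicUnit Obj Val)} {todo : List ℕ} {w : Window} {a b k au : ℕ}
  {prog : AtomicUnit Obj Val}

lemma step_fetch (h : s.Invariant) (hthread : s.thread t = .fetch) :
    (s.step aus t).Invariant := by
  simp only [step, hthread]
  refine h.goto (.refl _) h.safe ?_ ?_ (by simp [hthread, ThreadState.Pending])
  · split <;> trivial
  · split <;> simp [ThreadState.running?]

lemma step_beginTx (h : s.Invariant) (hthread : s.thread t = .beginTx au prog) :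
    (s.step aus t).Invariant := by
  have htx_lt {e} (he : e ∈ s.hist) : e.tx < s.clock := (h.timestamped.tx_mem_Ico he).2
  have hfresh (t') : (s.thread t').running? ≠ some s.clock := fun hi => by
    have hvalid := h.valid t'
    cases hthread' : s.thread t' <;> rw [hthread'] at hi hvalid <;> cases hi
    exact (htx_lt hvalid.beginTx_mem).ne rfl
  have hclock : ¬ Committed s.hist s.clock := fun hc => (htx_lt hc).ne rfl
  simp only [step, hthread]
  exact h.concat (h.run.beginTx au hclock) (h.timestamped.concat_beginTx au)
    (h.records.concat hclock (by simp)) (Execution.start fun e he => (htx_lt he).ne)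
    (fun t' _ => hfresh t') (by simp [ThreadState.running?, Event.tx, eq_comm])
    (by simp [hthread, ThreadState.Pending]) (fun _ _ => .inl)

lemma step_committed (h : s.Invariant) (hthread : s.thread t = .committed i) :
    (s.step aus t).Invariant := by
  simp only [step, hthread]
  refine h.goto (.refl _) h.safe ?_ ?_ ?_
  · split_ifs
    · trivial
    · exact fun k hk => h.records.accessConflict_iff.2 (.inl ((Finset.mem_sort _).1 hk))
  · split_ifs <;> simp [ThreadState.running?]
  · rw [hthread]
    rintro _ j hj rfl
    rw [if_neg (Finset.ne_empty_of_mem hj)]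
    exact .inl ⟨rfl, (Finset.mem_sort _).2 hj⟩

lemma step_loop (h : s.Invariant) (hthread : s.thread t = .loop i todo) :
    (s.step aus t).Invariant := by
  have hconf : ∀ k ∈ todo, AccessConflict s.hist i k := h.valid_of_eq hthread
  cases todo with
  | nil =>
    simp only [step, hthread]
    exact h.goto (.refl _) h.safe trivial (by simp [ThreadState.running?])
      (by simp [hthread, ThreadState.Pending])
  | cons j todo =>
    simp only [step, hthread]
    exact h.goto (.refl _) h.safe ⟨hconf, LockFreeList.linkedWindow_start _⟩
      (by simp [ThreadState.running?]) (by rw [hthread]; exact fun _ _ _ => .inl)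

lemma goto_addVert (h : s.Invariant) (hk : Committed s.hist k)
    (hw : LockFreeList.LinkedWindow s.graph w)
    (hp : s.graph.Extends (s.graph.addVertStep k (s.auOf k) w).1 →
      LockFreeList.Locates (s.graph.addVertStep k (s.auOf k) w).1 (tsKey k)
        (s.graph.addVertStep k (s.auOf k) w).2 →
      p.Valid (s.graph.addVertStep k (s.auOf k) w).1 s.hist)
    (hrunning : p.running? = none)
    (hpending : ∀ i j, (s.thread t).Pending i j → p.Pending i j) :
    ({ s with graph := (s.graph.addVertStep k (s.auOf k) w).1 }.goto t p).Invariant := by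
  have hspec := BlockGraph.insertSpec_addVertStep (i := k) (au := s.auOf k) h.safe hw
  have hG := BlockGraph.Extends.of_list hspec.extends_fst
  have hV : JustifiedVertex s.hist k (s.auOf k) := ⟨hk, h.timestamped.beginTx_mem_of_committed hk⟩
  exact h.goto hG (h.safe.of_insertSpec hV hspec) (hp hG hspec.locates) (by simp [hrunning])
    fun i j _ hij => .inl (hpending i j hij)

lemma step_addVertJ (h : s.Invariant) (hthread : s.thread t = .addVertJ i j todo w) :
    (s.step aus t).Invariant := by
  obtain ⟨hconf, hw⟩ := h.valid_of_eq hthread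
  have hj : Committed s.hist j := (hconf j List.mem_cons_self).2.2.1
  simp only [step, hthread]
  refine h.goto_addVert hj hw (fun _ hloc => ?_) ?_ ?_
  · rcases hr : (s.graph.addVertStep j (s.auOf j) w).2 with w' | a | a <;> rw [hr] at hloc
    · exact ⟨hconf, hloc⟩
    all_goals exact ⟨hconf, hloc, LockFreeList.linkedWindow_start _⟩
  · split <;> rfl
  · rw [hthread]
    split <;> exact fun _ _ => id

lemma step_addVertI (h : s.Invariant) (hthread : s.thread t = .addVertI i j todo a w) :
    (s.step aus t).Invariant := by
  obtain ⟨hconf, ha, hw⟩ := h.valid_of_eq hthread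
  have hi : Committed s.hist i := (hconf j List.mem_cons_self).2.1
  simp only [step, hthread]
  refine h.goto_addVert hi hw (fun hG hloc => ?_) ?_ ?_
  · have hedge {b} (hb : BlockGraph.VertexAt (s.graph.addVertStep i (s.auOf i) w).1 b i) :
        (if j < i then ThreadState.addEdge (Obj := Obj) (Val := Val) i j todo a b Window.start
          else .addEdge i j todo b a Window.start).Valid
          (s.graph.addVertStep i (s.auOf i) w).1 s.hist := by
      split_ifs with hji
      · refine ⟨hconf, ?_, ?_, LockFreeList.linkedWindow_start _⟩
        · simpa [hji.le] using ha.mono hG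
        · simpa [hji.le] using hb
      · refine ⟨hconf, ?_, ?_, LockFreeList.linkedWindow_start _⟩
        · simpa [not_lt.1 hji] using hb
        · simpa [not_lt.1 hji] using ha.mono hG
    rcases hr : (s.graph.addVertStep i (s.auOf i) w).2 with w' | b | b <;> rw [hr] at hloc
    exacts [⟨hconf, ha.mono hG, hloc⟩, hedge hloc, hedge hloc]
  · split
    · rfl
    all_goals split_ifs <;> rfl
  · rw [hthread]
    split
    · exact fun _ _ => id
    all_goals split_ifs <;> exact fun _ _ => id

lemma step_addEdge (h : s.Invariant) (hthread : s.thread t = .addEdge i j todo a b w) :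
    (s.step aus t).Invariant := by
  obtain ⟨hconf, ha, hb, hw⟩ := h.valid_of_eq hthread
  have hE : JustifiedEdge s.hist (min i j) (max i j) := (hconf j List.mem_cons_self).justifiedEdge
  have hG : s.graph.Extends (s.graph.addEdgeStep a b w).1 :=
    BlockGraph.extends_addEdgeStep h.safe ha.1 hw
  have hsafe := h.safe.addEdgeStep ha hb hE hw
  have hloc := BlockGraph.locates_addEdgeStep h.safe ha.1 hb hw
  have hconf_todo (k) (hk : k ∈ todo) := hconf k (List.mem_cons_of_mem j hk)
  have hpending_todo {e} (he : BlockGraph.EdgeAt (s.graph.addEdgeStep a b w).1 a e (max i j))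
      (i' k) : (s.thread t).Pending i' k → i = i' ∧ k ∈ todo ∨
        BlockGraph.HasEdge (s.graph.addEdgeStep a b w).1 (min i' k) (max i' k) := by
    rw [hthread]
    rintro ⟨rfl, hk⟩
    rcases List.mem_cons.1 hk with rfl | hk
    exacts [.inr (hsafe.hasEdge (ha.mono hG) he), .inl ⟨rfl, hk⟩]
  simp only [step, hthread]
  rcases hr : (s.graph.addEdgeStep a b w).2 with w' | e | e <;> rw [hr] at hloc
  · exact h.goto hG hsafe ⟨hconf, ha.mono hG, hb.mono hG, hloc⟩ (by simp [ThreadState.running?])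
      (by rw [hthread]; exact fun _ _ _ => .inl)
  · exact h.goto hG hsafe hconf_todo (by simp [ThreadState.running?])
      fun i' k _ => hpending_todo hloc i' k
  · exact h.goto hG hsafe ⟨hconf_todo, hG.linked hb.1⟩ (by simp [ThreadState.running?])
      fun i' k _ => hpending_todo hloc i' k

lemma step_incCnt (h : s.Invariant) (hthread : s.thread t = .incCnt i j todo b) :
    (s.step aus t).Invariant := by
  obtain ⟨hconf, hb⟩ := h.valid_of_eq hthread
  simp only [step, hthread]
  exact h.goto BlockGraph.extends_incInCnt (h.safe.incInCnt hb) hconf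
    (by simp [ThreadState.running?]) (by rw [hthread]; exact fun _ _ _ => .inl)

lemma step (h : s.Invariant) (aus : List (AtomicUnit Obj Val)) (t : Fin n) :
    (s.step aus t).Invariant := by
  cases hthread : s.thread t with
  | fetch => exact h.step_fetch hthread
  | beginTx => exact h.step_beginTx hthread
  | exec au prog i cont rset wlog =>
    simp only [Miner.step, hthread]
    cases cont with
    | ret => exact h.execStep_ret hthread
    | read => exact h.execStep_read hthread
    | write => exact h.execStep_write hthread
    | skip => exact h.execStep_skip hthread
  | committed => exact h.step_committed hthread
  | loop => exact h.step_loop hthread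
  | addVertJ => exact h.step_addVertJ hthread
  | addVertI => exact h.step_addVertI hthread
  | addEdge => exact h.step_addEdge hthread
  | incCnt => exact h.step_incCnt hthread
  | finished => simpa only [Miner.step, hthread] using h

end Invariant

lemma Reachable.invariant {aus : List (AtomicUnit Obj Val)} (hs : s.Reachable aus) :
    s.Invariant := by
  induction hs with
  | initial => exact invariant_initial
  | step t _ ih => exact ih.step aus t

lemma Invariant.hasEdge_of_conflicting (h : s.Invariant) (hij : Conflicting s.hist i j)
    (hi : ¬ s.Building i) (hj : ¬ s.Building j) : s.graph.HasEdge (min i j) (max i j) := by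
  rcases h.records.accessConflict_iff.1 (conflicting_iff_accessConflict.1 hij) with hmem | hmem
  · exact (h.captured hmem).resolve_right fun ⟨t, ht⟩ => hi ⟨t, ht.building?_eq⟩
  · rw [min_comm, max_comm]
    exact (h.captured hmem).resolve_right fun ⟨t, ht⟩ => hj ⟨t, ht.building?_eq⟩

lemma Invariant.lt_and_conflicting_of_edgeAt (h : s.Invariant) {a e : ℕ}
    (ha : s.graph.VertexAt a i) (he : s.graph.EdgeAt a e j) : i < j ∧ Conflicting s.hist i j :=
  (h.safe.edge ha he).1.imp_right conflicting_iff_accessConflict.2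

end Miner

theorem theorem3_general {Obj : Type u} {Val : Type v} [DecidableEq Obj] (M : STM Obj Val)
    (D : List (Event Obj Val) → ℕ → ℕ → Prop)
    (hD : ∀ {σ H k m}, M.Run σ H → D H k m → k < m ∧ Conflicting H k m)
    (n : ℕ) (aus : List (AtomicUnit Obj Val)) (s : Miner M n) (hs : Miner.Reachable aus s) :
    (∀ a i, s.graph.VertexAt a i →
      Committed s.hist i ∧ Event.beginTx i (s.graph.node a).data.auId ∈ s.hist) ∧
    (∀ a e i j, s.graph.VertexAt a i → s.graph.EdgeAt a e j →
      i < j ∧ s.graph.VertexAt (s.graph.target a e) j ∧ Conflicting s.hist i j) ∧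
    (∀ i j, Conflicting s.hist i j → ¬ s.Building i → ¬ s.Building j →
      s.graph.HasEdge (min i j) (max i j)) ∧
    (∀ k m, D s.hist k m → ¬ s.Building k → ¬ s.Building m → k < m ∧ s.graph.HasEdge k m) ∧
    (s.Finished → ∀ i j, s.graph.HasEdge i j ↔ i < j ∧ Conflicting s.hist i j) := by
  have h : s.Invariant := hs.invariant
  have hasEdge {i j} (hij : i < j ∧ Conflicting s.hist i j) (hi : ¬ s.Building i)
      (hj : ¬ s.Building j) : s.graph.HasEdge i j := by
    simpa only [min_eq_left hij.1.le, max_eq_right hij.1.le] using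
      h.hasEdge_of_conflicting hij.2 hi hj
  refine ⟨fun a i ha => h.safe.vertex ha, fun a e i j ha he => ?_,
    fun i j hij hi hj => h.hasEdge_of_conflicting hij hi hj, fun k m hkm hk hm => ?_,
    fun hfin i j => ⟨fun ⟨a, e, ha, he, _⟩ => h.lt_and_conflicting_of_edgeAt ha he,
      fun hij => hasEdge hij (hfin.not_building i) (hfin.not_building j)⟩⟩
  · obtain ⟨hlt, hconf⟩ := h.lt_and_conflicting_of_edgeAt ha he
    exact ⟨hlt, (h.safe.edge ha he).2, hconf⟩
  · exact ⟨(hD h.run hkm).1, hasEdge (hD h.run hkm) hk hm⟩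

theorem theorem3 {Obj : Type u} {Val : Type v} [DecidableEq Obj] (P : Protocol) (x₀ : Obj → Val)
    (n : ℕ) (aus : List (AtomicUnit Obj Val)) (s : Miner (P.stm x₀) n)
    (hs : Miner.Reachable aus s) :
    -- the vertices are committed transactions, labelled with the atomic-units they execute
    (∀ a i, s.graph.VertexAt a i →
      Committed s.hist i ∧ Event.beginTx i (s.graph.node a).data.auId ∈ s.hist) ∧
    -- every edge points from the lower to the higher timestamp, and stands for a conflict
    (∀ a e i j, s.graph.VertexAt a i → s.graph.EdgeAt a e j →
      i < j ∧ s.graph.VertexAt (s.graph.target a e) j ∧ Conflicting s.hist i j) ∧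
    -- every conflict between transactions whose graph construction is over is captured
    (∀ i j, Conflicting s.hist i j → ¬ s.Building i → ¬ s.Building j →
      s.graph.HasEdge (min i j) (max i j)) ∧
    -- every dependency is captured, in its own direction
    (∀ k m, Dependency P s.hist k m → ¬ s.Building k → ¬ s.Building m →
      k < m ∧ s.graph.HasEdge k m) ∧
    -- the final graph consists of exactly the conflicts, directed by the timestamps
    (s.Finished → ∀ i j, s.graph.HasEdge i j ↔ i < j ∧ Conflicting s.hist i j) :=
  theorem3_general (P.stm x₀) (Dependency P) Dependency.lt_and_conflicting n aus s hs
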